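/- Theorem 1.4. **Setting.** The input is a finite nonempty simple undirected graph $G=(V,E)$ without isolated vertices, whose vertices carry distinct identifiers from $\mathbb N$; write $n=|V|$, $m=|E|$, and $d=2m/n$ for the average degree. A randomized, adaptive algorithm knows nothing about $G$ in advance (in particular not $n$) and accesses $G$ only through queries. In the *advanced model* the queries are: a uniformly random vertex, a uniformly random neighbour of a given vertex, the degree of a given vertex (each of cost $1$), and, for a given set $S\subseteq V$, the number of edges with both endpoints in $S$ (at cost $|S|$). In the stronger *full adjacency model* one may in addition ask, at cost $1$, for the whole set of neighbours of a given vertex. Random edges cannot be sampled in either model. "Number of queries" means the total cost of the queries. For $c\ge 1$, a value $v$ is a $c$-approximation to $d$ if $d/c\le v\le c\,d$. (a) There are constants $C>0$ and $k\in\mathbb N$ and, for every $\varepsilon\in(0,1)$, an algorithm in the advanced model, which only asks about vertices that it has already received in answers, such that on every input graph, with probability greater than $0.99$, it outputs a $(1+\varepsilon)$-approximation to $d$ after at most $C\,\varepsilon^{-2}\sqrt{n/d}\,(\log n)^k$ queries; that is, it makes $\widetilde O(\varepsilon^{-2}\sqrt{n/d})$ queries. (b) Any constant-factor approximation requires $\Omega(\sqrt{n/d})$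 queries, even in the full adjacency model. Precisely: for every $c>1$ there is $\kappa>0$ such that the following holds for every algorithm in the full adjacency model that, on every input graph, outputs a $c$-approximation to the average degree with probability at least $2/3$. For every $n\in\mathbb N$ and every real $d_0$ with $1\le d_0\le n-1$ there is an input graph with exactly $n$ vertices and average degree $d\in[d_0/2,\,2d_0]$ on which, with probability at least $1/4$, the algorithm halts after at least $\kappa\sqrt{n/d}$ queries. -/

import Mathlib

namespace AvgDegree

/-- An input graph: a finite, nonempty, simple undirected graph without isolated vertices. Its
vertices carry distinct identifiers from the infinite universe `ℕ`, and a vertex is identified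
with its identifier; `verts` is an arbitrary finite subset of `ℕ`. -/
structure InputGraph where
  verts : Finset ℕ
  graph : SimpleGraph ℕ
  nonempty : verts.Nonempty
  mem_of_adj : ∀ x y, graph.Adj x y → x ∈ verts
  exists_adj : ∀ x ∈ verts, ∃ y, graph.Adj x y

namespace InputGraph

variable (G : InputGraph)

/-- `n = |V|`. -/
def numVerts : ℕ := G.verts.card

open Classical in
/-- The set of neighbours of `x`. -/
noncomputable def nbrs (x : ℕ) : Finset ℕ := G.verts.filter (fun y => G.graph.Adj x y)

open Classical in
/-- The number of edges of `G` with both endpoints in `S`. -/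
noncomputable def edgesIn (S : Finset ℕ) : ℕ :=
  (S.sym2.filter (fun e => e ∈ G.graph.edgeSet)).card

/-- `m = |E|`. -/
noncomputable def numEdges : ℕ := G.edgesIn G.verts

/-- The average degree `d = 2m/n`. -/
noncomputable def avgDegree : ℝ := 2 * (G.numEdges : ℝ) / (G.numVerts : ℝ)

end InputGraph

/-- The queries: uniform random vertex, uniform random neighbour of a vertex, degree of a vertex,
number of edges inside a vertex set, and the whole neighbourhood of a vertex.
There is no query for a random edge and none for the number of vertices. -/
inductive Query : Type
  | randVert
  | randNbr (x : ℕ)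
  | degree (x : ℕ)
  | additive (S : Finset ℕ)
  | fullNbr (x : ℕ)

/-- The cost of a query: `|S|` for an additive query on `S`, and `1` for any other query. -/
def Query.cost : Query → ℕ
  | .additive S => S.card
  | _ => 1

/-- The vertices that a query mentions. -/
def Query.vertices : Query → Finset ℕ
  | .randVert => ∅
  | .randNbr x => {x}
  | .degree x => {x}
  | .additive S => S
  | .fullNbr x => {x}

/-- The advanced model: random vertices, random neighbours, degrees and additive queries, but no
access to full neighbourhoods. -/
def advancedModel : Set Query := {q | ∀ x, q ≠ Query.fullNbr x}

/-- Answers to queries; `invalid` is the answer to a query that mentions a non-vertex. -/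
inductive Answer : Type
  | vertex (x : ℕ)
  | number (k : ℕ)
  | vertexSet (S : Finset ℕ)
  | invalid

/-- The vertices that an answer reveals. -/
def Answer.vertices : Answer → Finset ℕ
  | .vertex x => {x}
  | .number _ => ∅
  | .vertexSet S => S
  | .invalid => ∅

open Classical in
/-- The distribution of the answer to a query. (In an input graph `nbrs x` is nonempty exactly
when `x` is a vertex.) -/
noncomputable def InputGraph.answer (G : InputGraph) : Query → PMF Answer
  | .randVert => (PMF.uniformOfFinset G.verts G.nonempty).map Answer.vertex
  | .randNbr x =>
      if h : (G.nbrs x).Nonempty then (PMF.uniformOfFinset (G.nbrs x) h).map Answer.vertex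
      else PMF.pure Answer.invalid
  | .degree x =>
      if x ∈ G.verts then PMF.pure (Answer.number (G.nbrs x).card)
      else PMF.pure Answer.invalid
  | .additive S =>
      if S ⊆ G.verts then PMF.pure (Answer.number (G.edgesIn S))
      else PMF.pure Answer.invalid
  | .fullNbr x =>
      if x ∈ G.verts then PMF.pure (Answer.vertexSet (G.nbrs x))
      else PMF.pure Answer.invalid

/-- What an algorithm can do next: halt with a real output, or ask a query and continue in a state
that depends on the answer. -/
inductive Move (σ : Type) : Type
  | output (v : ℝ)
  | ask (q : Query) (next : Answer → σ)

/-- A randomized, adaptive query algorithm, possibly non-terminating: it has a set of internal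
states and in each state chooses its next move at random. It has no input besides the answers to
its queries; in particular it does not know the number of vertices. Any query of `Query` may be
asked, and about any identifier. -/
structure Algorithm where
  State : Type
  init : State
  act : State → PMF (Move State)

namespace Algorithm

variable (A : Algorithm)

/-- The distribution of (output, total cost of the queries) when `A` is started in state `s` and
makes at most `t` moves; `none` if it has not halted by then. -/
noncomputable def outcome (G : InputGraph) : ℕ → A.State → PMF (Option (ℝ × ℕ))
  | 0, _ => PMF.pure none
  | t + 1, s => (A.act s).bind fun mv =>
      match mv with
      | .output v => PMF.pure (some (v, 0))
      | .ask q next => (G.answer q).bind fun a =>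
          (outcome G t (next a)).map (Option.map fun r => (r.1, q.cost + r.2))

/-- The probability that `A`, run on `G`, halts with an output `v` after queries of total cost `q`
such that `E v q` holds (the limit over the number of moves, which is an increasing one). -/
noncomputable def prob (G : InputGraph) (E : ℝ → ℕ → Prop) : ENNReal :=
  ⨆ t : ℕ, (A.outcome G t A.init).toOuterMeasure {o | ∃ v q, o = some (v, q) ∧ E v q}

/-- All queries that `A` can ask belong to `M`. -/
def InModel (M : Set Query) : Prop :=
  ∀ s q next, Move.ask q next ∈ (A.act s).support → q ∈ M

/-- `A.Reachable G s K`: some run of `A` on `G` reaches state `s`, the vertices revealed by the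
answers obtained on the way being those in `K`. -/
inductive Reachable (G : InputGraph) : A.State → Finset ℕ → Prop
  | start : Reachable G A.init ∅
  | step (s : A.State) (K : Finset ℕ) (q : Query) (next : Answer → A.State) (a : Answer) :
      Reachable G s K → Move.ask q next ∈ (A.act s).support → a ∈ (G.answer q).support →
      Reachable G (next a) (K ∪ a.vertices)

/-- On `G`, the algorithm only ever asks about vertices revealed by earlier answers, so it does
not guess identifiers. -/
def OnlyDiscovered (G : InputGraph) : Prop :=
  ∀ s K q next, A.Reachable G s K → Move.ask q next ∈ (A.act s).support → q.vertices ⊆ K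

end Algorithm

/-- `v` is a `c`-approximation to `d`. For `c = 1 + ε` this implies `(1 - ε) d ≤ v ≤ (1 + ε) d`. -/
def IsApprox (c d v : ℝ) : Prop := d / c ≤ v ∧ v ≤ c * d

end AvgDegree

/-!
*Upper bound.* Put `θ = √(nd)` and `X = √(n/d)`, so that `θ = X d` and `n = X θ`. Order the
vertices by degree, breaking ties by identifier. For a random vertex `v` and a random neighbour
`u` of `v`, the weight `2 deg v` if `v < u`, and `0` otherwise, is an unbiased estimate of `d`.
At most `θ` neighbours of a vertex follow it in the order, so the second moment is at most
`4 θ d`, and a number of samples of the order of `X / ε²` suffices. As `X` is unknown, a doubling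
search looks for a number `s` of the order of `X`, with a test that succeeds with probability
`O((s/X)²)` and fails with probability `O(X/s)`. If many edges join vertices on the same side of
the degree threshold `θ`, a set of `2 s` random vertices spans an edge once `s` exceeds `X`.
Otherwise many edges lead from a low vertex to a high one, and edge samples find a vertex `u`
with `deg u > θ`; the sampled weights estimate `s d`, the hits of `s` random vertices on the
neighbourhood of `u` estimate `s deg u / n`, and their product exceeds `deg u` once `s` exceeds
`X`. If `s` is much larger than `X` the search ends, and if it is much smaller a premature end
is unlikely; as the accuracy of the estimate improves with `s`, the probabilities of a wrong
output sum to a small constant.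

*Lower bound.* In the graph in which `⌊d⌋` hubs are adjacent to all vertices, a clique on about
`c √(nd)` vertices may be planted in any one of about `√(n/d) / c` disjoint blocks, and planting
it multiplies the average degree by more than `c²`. A query of cost `q` tells at most `q` of the
planted graphs apart from the original one, so an algorithm that makes few queries behaves in
the same way on most of them, and cannot be correct on both.
-/

namespace AvgDegree

open scoped Finset ENNReal NNReal

section Expectation

variable {α β : Type*}

/-- The expectation of a nonnegative function under a discrete distribution. -/
noncomputable def expect (p : PMF α) (f : α → ℝ≥0∞) : ℝ≥0∞ := ∑' a, p a * f a

theorem expect_pure (a : α) (f : α → ℝ≥0∞) : expect (PMF.pure a) f = f a := by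
  rw [expect, tsum_eq_single a fun b hb => by simp [PMF.pure_apply, hb]]
  simp

theorem expect_bind (p : PMF α) (g : α → PMF β) (f : β → ℝ≥0∞) :
    expect (p.bind g) f = expect p fun a => expect (g a) f := by
  simp only [expect, PMF.bind_apply, ← ENNReal.tsum_mul_right, ← ENNReal.tsum_mul_left]
  rw [ENNReal.tsum_comm]
  simp only [mul_assoc]

theorem expect_map (p : PMF α) (g : α → β) (f : β → ℝ≥0∞) :
    expect (p.map g) f = expect p fun a => f (g a) := by
  simp only [← PMF.bind_pure_comp, expect_bind, Function.comp, expect_pure]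

theorem expect_const (p : PMF α) (c : ℝ≥0∞) : expect p (fun _ => c) = c := by
  rw [expect, ENNReal.tsum_mul_right, p.tsum_coe, one_mul]

theorem expect_add (p : PMF α) (f g : α → ℝ≥0∞) :
    expect p (fun a => f a + g a) = expect p f + expect p g := by
  simp only [expect, ← ENNReal.tsum_add, mul_add]

theorem expect_const_mul (p : PMF α) (c : ℝ≥0∞) (f : α → ℝ≥0∞) :
    expect p (fun a => c * f a) = c * expect p f := by
  simp only [expect, ← ENNReal.tsum_mul_left, mul_left_comm]

theorem expect_mul_const (p : PMF α) (c : ℝ≥0∞) (f : α → ℝ≥0∞) :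
    expect p (fun a => f a * c) = expect p f * c := by
  simp only [mul_comm _ c, expect_const_mul]

theorem expect_mono_of_support {p : PMF α} {f g : α → ℝ≥0∞} (h : ∀ a ∈ p.support, f a ≤ g a) :
    expect p f ≤ expect p g := by
  refine ENNReal.tsum_le_tsum fun a => ?_
  by_cases ha : a ∈ p.support
  · gcongr
    exact h a ha
  · simp [(p.apply_eq_zero_iff a).mpr ha]

theorem expect_mono {p : PMF α} {f g : α → ℝ≥0∞} (h : ∀ a, f a ≤ g a) :
    expect p f ≤ expect p g :=
  expect_mono_of_support fun a _ => h a

theorem expect_congr_of_support {p : PMF α} {f g : α → ℝ≥0∞} (h : ∀ a ∈ p.support, f a = g a) :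
    expect p f = expect p g :=
  le_antisymm (expect_mono_of_support fun a ha => (h a ha).le)
    (expect_mono_of_support fun a ha => (h a ha).ge)

theorem expect_le_of_forall_le {p : PMF α} {f : α → ℝ≥0∞} {c : ℝ≥0∞} (h : ∀ a, f a ≤ c) :
    expect p f ≤ c :=
  (expect_mono h).trans (expect_const p c).le

theorem expect_sum {ι : Type*} (p : PMF α) (s : Finset ι) (f : ι → α → ℝ≥0∞) :
    expect p (fun a => ∑ i ∈ s, f i a) = ∑ i ∈ s, expect p (f i) := by
  simp only [expect, Finset.mul_sum]
  exact Summable.tsum_finsetSum fun _ _ => ENNReal.summable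

theorem expect_list_sum (p : PMF α) (l : List β) (f : β → α → ℝ≥0∞) :
    expect p (fun a => (l.map fun b => f b a).sum) = (l.map fun b => expect p (f b)).sum := by
  induction l with
  | nil => simp only [List.map_nil, List.sum_nil, expect_const]
  | cons b l ih => simp only [List.map_cons, List.sum_cons, expect_add, ih]

theorem expect_comm (p : PMF α) (q : PMF β) (f : α → β → ℝ≥0∞) :
    (expect p fun a => expect q fun b => f a b) = expect q fun b => expect p fun a => f a b := by
  simp only [expect, ← ENNReal.tsum_mul_left]
  rw [ENNReal.tsum_comm]
  simp only [mul_left_comm]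

theorem expect_uniformOfFinset_ofReal {s : Finset α} (hs : s.Nonempty) {f : α → ℝ}
    (hf : ∀ x ∈ s, 0 ≤ f x) :
    expect (PMF.uniformOfFinset s hs) (fun x => ENNReal.ofReal (f x)) =
      ENNReal.ofReal ((∑ x ∈ s, f x) / #s) := by
  rw [expect, tsum_eq_sum (s := s) fun a ha => by
      rw [PMF.uniformOfFinset_apply_of_notMem _ ha, zero_mul],
    ENNReal.ofReal_div_of_pos (by exact_mod_cast hs.card_pos), ENNReal.ofReal_sum_of_nonneg hf,
    ENNReal.ofReal_natCast, ENNReal.div_eq_inv_mul, Finset.mul_sum]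
  exact Finset.sum_congr rfl fun a ha => by rw [PMF.uniformOfFinset_apply_of_mem _ ha]

end Expectation

section Probability

variable {α β : Type*}

/-- The probability of an event under a discrete distribution. -/
noncomputable def pr (p : PMF α) (E : α → Prop) : ℝ≥0∞ := p.toOuterMeasure {a | E a}

theorem pr_eq_expect (p : PMF α) (E : α → Prop) [DecidablePred E] :
    pr p E = expect p fun a => if E a then 1 else 0 := by
  rw [pr, PMF.toOuterMeasure_apply]
  refine tsum_congr fun a => ?_
  by_cases ha : E a <;> simp [ha]

theorem pr_bind (p : PMF α) (g : α → PMF β) (E : β → Prop) :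
    pr (p.bind g) E = expect p fun a => pr (g a) E := by
  classical
  simp only [pr_eq_expect, expect_bind]

theorem pr_map (p : PMF α) (g : α → β) (E : β → Prop) :
    pr (p.map g) E = pr p fun a => E (g a) :=
  p.toOuterMeasure_map_apply g _

theorem pr_mono {p : PMF α} {E F : α → Prop} (h : ∀ a ∈ p.support, E a → F a) :
    pr p E ≤ pr p F :=
  p.toOuterMeasure_mono fun a ha => h a ha.2 ha.1

theorem pr_le_one (p : PMF α) (E : α → Prop) : pr p E ≤ 1 := by
  classical
  rw [pr_eq_expect]
  exact expect_le_of_forall_le fun a => by split_ifs <;> simp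

theorem pr_or_le (p : PMF α) (E F : α → Prop) : pr p (fun a => E a ∨ F a) ≤ pr p E + pr p F :=
  MeasureTheory.measure_union_le _ _

theorem pr_bind_le_add {p : PMF α} {g : α → PMF β} {E : β → Prop} {B : α → Prop} {c : ℝ≥0∞}
    (h : ∀ a ∈ p.support, ¬ B a → pr (g a) E ≤ c) : pr (p.bind g) E ≤ pr p B + c := by
  classical
  rw [pr_bind, pr_eq_expect, ← expect_const p c, ← expect_add]
  refine expect_mono_of_support fun a ha => ?_
  by_cases hB : B a
  · exact (pr_le_one _ _).trans (by simp [hB])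
  · simpa [hB] using h a ha hB

theorem pr_uniformOfFinset_mem {s t : Finset α} (hs : s.Nonempty) (hts : t ⊆ s) :
    pr (PMF.uniformOfFinset s hs) (fun x => x ∈ t) = ENNReal.ofReal ((#t : ℝ) / #s) := by
  classical
  have h := expect_uniformOfFinset_ofReal hs (f := fun x => if x ∈ t then 1 else 0)
    fun x _ => by split_ifs <;> simp
  simp only [Finset.sum_ite_mem, Finset.inter_eq_right.mpr hts, Finset.sum_const, nsmul_one] at h
  rw [pr_eq_expect, ← h]
  congr 1
  funext x
  split_ifs <;> simp

/-- Markov's inequality, multiplied out so that `c = 0` and `c = ∞` need no exception. -/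
theorem mul_pr_le_expect (p : PMF α) {E : α → Prop} {f : α → ℝ≥0∞} {c : ℝ≥0∞}
    (h : ∀ a ∈ p.support, E a → c ≤ f a) : c * pr p E ≤ expect p f := by
  classical
  rw [pr_eq_expect, ← expect_const_mul]
  refine expect_mono_of_support fun a ha => ?_
  by_cases hE : E a
  · simpa [hE] using h a ha hE
  · simp [hE]

theorem pr_le_ofReal_div_of_le_expect {p : PMF α} {E : α → Prop} {f : α → ℝ≥0∞} {c v : ℝ}
    (hc : 0 < c) (hf : expect p f ≤ ENNReal.ofReal v)
    (h : ∀ a ∈ p.support, E a → ENNReal.ofReal c ≤ f a) : pr p E ≤ ENNReal.ofReal (v / c) := by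
  rw [ENNReal.ofReal_div_of_pos hc, ENNReal.le_div_iff_mul_le (by simp [hc]) (by simp), mul_comm]
  exact (mul_pr_le_expect p h).trans hf

theorem expect_sub_sq_le {p : PMF α} {Y : α → ℝ≥0} {μ V : ℝ} (hμ : 0 ≤ μ) (hV : 0 ≤ V)
    (h1 : expect p (fun a => (Y a : ℝ≥0∞)) = ENNReal.ofReal μ)
    (h2 : expect p (fun a => (Y a : ℝ≥0∞) ^ 2) ≤ ENNReal.ofReal (μ ^ 2 + V)) :
    expect p (fun a => ENNReal.ofReal (((Y a : ℝ) - μ) ^ 2)) ≤ ENNReal.ofReal V := by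
  have expand : ∀ a, ENNReal.ofReal (((Y a : ℝ) - μ) ^ 2) + ENNReal.ofReal (2 * μ) * Y a =
      (Y a : ℝ≥0∞) ^ 2 + ENNReal.ofReal (μ ^ 2) := by
    intro a
    rw [← ENNReal.ofReal_coe_nnreal, ← ENNReal.ofReal_mul (by positivity),
      ← ENNReal.ofReal_pow (by positivity), ← ENNReal.ofReal_add (by positivity) (by positivity),
      ← ENNReal.ofReal_add (by positivity) (by positivity)]
    congr 1
    ring
  refine (ENNReal.add_le_add_iff_right (a := ENNReal.ofReal (2 * μ) * ENNReal.ofReal μ)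
    (by finiteness)).mp ?_
  calc expect p (fun a => ENNReal.ofReal (((Y a : ℝ) - μ) ^ 2)) +
        ENNReal.ofReal (2 * μ) * ENNReal.ofReal μ
      = expect p (fun a => (Y a : ℝ≥0∞) ^ 2) + ENNReal.ofReal (μ ^ 2) := by
        rw [← h1, ← expect_const_mul, ← expect_add]
        simp only [expand, expect_add, expect_const]
    _ ≤ ENNReal.ofReal (μ ^ 2 + V) + ENNReal.ofReal (μ ^ 2) := by gcongr
    _ = ENNReal.ofReal V + ENNReal.ofReal (2 * μ) * ENNReal.ofReal μ := by
        rw [← ENNReal.ofReal_mul (by positivity),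
          ← ENNReal.ofReal_add (by positivity) (by positivity),
          ← ENNReal.ofReal_add (by positivity) (by positivity)]
        congr 1
        ring

/-- Chebyshev's inequality, with the bound `V` on the variance given through the second moment. -/
theorem pr_le_abs_sub_le {p : PMF α} {Y : α → ℝ≥0} {μ V r : ℝ} (hμ : 0 ≤ μ) (hV : 0 ≤ V)
    (hr : 0 < r) (h1 : expect p (fun a => (Y a : ℝ≥0∞)) = ENNReal.ofReal μ)
    (h2 : expect p (fun a => (Y a : ℝ≥0∞) ^ 2) ≤ ENNReal.ofReal (μ ^ 2 + V)) :
    pr p (fun a => r ≤ |(Y a : ℝ) - μ|) ≤ ENNReal.ofReal (V / r ^ 2) := by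
  refine pr_le_ofReal_div_of_le_expect (by positivity) (expect_sub_sq_le hμ hV h1 h2)
    fun a _ ha => ENNReal.ofReal_le_ofReal ?_
  rw [← sq_abs ((Y a : ℝ) - μ)]
  gcongr

theorem pr_eq_zero_le {p : PMF α} {Y : α → ℝ≥0} {μ V : ℝ} (hμ : 0 < μ) (hV : 0 ≤ V)
    (h1 : expect p (fun a => (Y a : ℝ≥0∞)) = ENNReal.ofReal μ)
    (h2 : expect p (fun a => (Y a : ℝ≥0∞) ^ 2) ≤ ENNReal.ofReal (μ ^ 2 + V)) :
    pr p (fun a => Y a = 0) ≤ ENNReal.ofReal (V / μ ^ 2) := by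
  refine (pr_mono fun a _ ha => ?_).trans (pr_le_abs_sub_le hμ.le hV hμ h1 h2)
  rw [ha, NNReal.coe_zero, zero_sub, abs_neg, abs_of_pos hμ]

end Probability

section IndependentSamples

variable {α : Type*}

/-- The distribution of a list of `N` independent samples. -/
noncomputable def iid (p : PMF α) : ℕ → PMF (List α)
  | 0 => PMF.pure []
  | N + 1 => p.bind fun a => (iid p N).bind fun l => PMF.pure (a :: l)

theorem expect_iid_succ (p : PMF α) (N : ℕ) (f : List α → ℝ≥0∞) :
    expect (iid p (N + 1)) f = expect p fun a => expect (iid p N) fun l => f (a :: l) := by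
  simp only [iid, expect_bind, expect_pure]

theorem expect_iid_add (p : PMF α) (M N : ℕ) (f : List α → ℝ≥0∞) :
    expect (iid p (M + N)) f =
      expect (iid p M) fun l => expect (iid p N) fun l' => f (l ++ l') := by
  induction M generalizing f with
  | zero => simp only [Nat.zero_add, iid, expect_pure, List.nil_append]
  | succ M ih =>
    rw [Nat.add_right_comm, expect_iid_succ, expect_iid_succ]
    simp only [ih, List.cons_append]

theorem mem_support_of_mem_iid {p : PMF α} {N : ℕ} {l : List α} (hl : l ∈ (iid p N).support)
    {a : α} (ha : a ∈ l) : a ∈ p.support := by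
  induction N generalizing l with
  | zero =>
    rw [iid, PMF.mem_support_pure_iff] at hl
    simp [hl] at ha
  | succ N ih =>
    simp only [iid, PMF.mem_support_bind_iff, PMF.mem_support_pure_iff] at hl
    obtain ⟨b, hb, l', hl', rfl⟩ := hl
    rcases List.mem_cons.mp ha with rfl | ha
    · exact hb
    · exact ih hl' ha

theorem expect_iid_sum (p : PMF α) (f : α → ℝ≥0∞) (N : ℕ) :
    (expect (iid p N) fun l => (l.map f).sum) = N * expect p f := by
  induction N with
  | zero => simp [iid, expect_pure]
  | succ N ih =>
    simp only [expect_iid_succ, List.map_cons, List.sum_cons, expect_add, expect_const, ih]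
    push_cast
    ring

theorem expect_iid_sum_sum_le (p : PMF α) (f : α → α → ℝ≥0∞) (N : ℕ) :
    (expect (iid p N) fun l => (l.map fun x => (l.map fun y => f x y).sum).sum) ≤
      N * expect p (fun x => f x x) +
        (N : ℝ≥0∞) ^ 2 * expect p fun x => expect p fun y => f x y := by
  induction N with
  | zero => simp [iid, expect_pure]
  | succ N ih =>
    simp only [expect_iid_succ, List.map_cons, List.sum_cons, List.sum_map_add, expect_add,
      expect_const, expect_iid_sum, expect_const_mul, expect_comm p p fun a b => f b a]
    set u := expect p fun x => f x x
    set v := expect p fun x => expect p fun y => f x y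
    calc _ ≤ u + N * v + (N * v + (N * u + (N : ℝ≥0∞) ^ 2 * v)) := by gcongr
      _ ≤ u + N * v + (N * v + (N * u + (N : ℝ≥0∞) ^ 2 * v)) + v := le_self_add
      _ = _ := by push_cast; ring

theorem expect_iid_sum_sq_le (p : PMF α) (f : α → ℝ≥0∞) (N : ℕ) :
    (expect (iid p N) fun l => (l.map f).sum ^ 2) ≤
      N * expect p (fun x => f x ^ 2) + (N * expect p f) ^ 2 := by
  have h := expect_iid_sum_sum_le p (fun x y => f x * f y) N
  simp only [List.sum_map_mul_left, List.sum_map_mul_right, expect_const_mul, expect_mul_const,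
    ← sq] at h
  rwa [mul_pow]

theorem coe_sum_map (l : List α) (f : α → ℝ≥0) :
    (((l.map f).sum : ℝ≥0) : ℝ≥0∞) = (l.map fun a => (f a : ℝ≥0∞)).sum := by
  induction l with
  | nil => simp
  | cons a l ih => simp [ih]

theorem pr_iid_le_abs_sum_sub_le {p : PMF α} {f : α → ℝ≥0} {N : ℕ} {μ V r : ℝ} (hμ : 0 ≤ μ)
    (hV : 0 ≤ V) (hr : 0 < r) (h1 : expect p (fun a => (f a : ℝ≥0∞)) = ENNReal.ofReal μ)
    (h2 : expect p (fun a => (f a : ℝ≥0∞) ^ 2) ≤ ENNReal.ofReal V) :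
    pr (iid p N) (fun l => r ≤ |((l.map f).sum : ℝ) - N * μ|) ≤
      ENNReal.ofReal (N * V / r ^ 2) := by
  have mean : expect (iid p N) (fun l => ((l.map f).sum : ℝ≥0∞)) = ENNReal.ofReal (N * μ) := by
    simp only [coe_sum_map, expect_iid_sum, h1]
    rw [ENNReal.ofReal_mul (by positivity), ENNReal.ofReal_natCast]
  refine pr_le_abs_sub_le (by positivity) (by positivity) hr mean ?_
  simp only [coe_sum_map]
  refine (expect_iid_sum_sq_le p _ N).trans ?_
  rw [h1, add_comm, ENNReal.ofReal_add (by positivity) (by positivity), ENNReal.ofReal_pow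
    (by positivity), ENNReal.ofReal_mul (by positivity), ENNReal.ofReal_mul (by positivity),
    ENNReal.ofReal_natCast]
  gcongr

theorem pr_iid_forall_not_le {p : PMF α} {E : α → Prop} {N : ℕ} (hN : 0 < N) {μ : ℝ}
    (hμ : 0 < μ) (h : pr p E = ENNReal.ofReal μ) :
    pr (iid p N) (fun l => ∀ x ∈ l, ¬ E x) ≤ ENNReal.ofReal (1 / (N * μ)) := by
  classical
  let f : α → ℝ≥0 := fun a => if E a then 1 else 0
  have hf : ∀ a, (f a : ℝ≥0∞) = if E a then 1 else 0 := fun a => by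
    simp only [f]; split_ifs <;> simp
  have mean : expect p (fun a => (f a : ℝ≥0∞)) = ENNReal.ofReal μ := by
    simp only [hf, ← pr_eq_expect, h]
  have second : expect p (fun a => (f a : ℝ≥0∞) ^ 2) ≤ ENNReal.ofReal μ := by
    simp only [hf, ite_pow, one_pow, ne_eq, OfNat.ofNat_ne_zero, not_false_eq_true, zero_pow,
      ← pr_eq_expect, h, le_refl]
  have hNμ : 0 < N * μ := by positivity
  calc pr (iid p N) (fun l => ∀ x ∈ l, ¬ E x)
      ≤ pr (iid p N) (fun l => N * μ ≤ |((l.map f).sum : ℝ) - N * μ|) := by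
        refine pr_mono fun l _ hl => ?_
        have hsum : (l.map f).sum = 0 := by
          rw [List.sum_eq_zero_iff, List.forall_mem_map]
          exact fun a ha => if_neg (hl a ha)
        rw [hsum, NNReal.coe_zero, zero_sub, abs_neg, abs_of_pos hNμ]
    _ ≤ ENNReal.ofReal (N * μ / (N * μ) ^ 2) :=
        pr_iid_le_abs_sum_sub_le hμ.le hμ.le hNμ mean second
    _ = ENNReal.ofReal (1 / (N * μ)) := by congr 1; field_simp

section RelatedPairs

variable {p : PMF α} {F : α → α → ℝ≥0∞}

theorem expect_iid_iid_sum_sum (p : PMF α) (F : α → α → ℝ≥0∞) (N : ℕ) :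
    (expect (iid p N) fun l => expect (iid p N) fun l' =>
      (l'.map fun y => (l.map fun x => F x y).sum).sum) =
        (N : ℝ≥0∞) ^ 2 * expect p fun x => expect p fun y => F x y := by
  simp only [expect_iid_sum, expect_list_sum, expect_const_mul]
  ring

theorem expect_sq_le_mul_expect {g : α → ℝ≥0∞} {τ : ℝ≥0∞} (hg : ∀ x, g x ≤ τ) :
    expect p (fun x => g x ^ 2) ≤ τ * expect p g := by
  rw [← expect_const_mul]
  refine expect_mono fun x => ?_
  rw [sq]
  gcongr
  exact hg x

/-- Two pairs of indices contribute independently unless they share an index. Sharing both gives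
the first term, and sharing one gives the second. -/
theorem expect_iid_iid_sum_sum_sq_le (hF : ∀ x y, F x y ^ 2 = F x y) {τ P : ℝ≥0∞}
    (h₁ : ∀ x, expect p (fun y => F x y) ≤ τ) (h₂ : ∀ y, expect p (fun x => F x y) ≤ τ)
    (hP : (expect p fun x => expect p fun y => F x y) = P) (N : ℕ) :
    (expect (iid p N) fun l => expect (iid p N) fun l' =>
      (l'.map fun y => (l.map fun x => F x y).sum).sum ^ 2) ≤
        (N : ℝ≥0∞) ^ 2 * P + 2 * N ^ 3 * τ * P + (N ^ 2 * P) ^ 2 := by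
  have hP' : (expect p fun y => expect p fun x => F x y) = P := by rw [← hP, expect_comm]
  calc _ ≤ expect (iid p N) fun l => N * expect p (fun y => (l.map fun x => F x y).sum ^ 2) +
        (N * (l.map fun x => expect p fun y => F x y).sum) ^ 2 := by
        refine expect_mono fun l => (expect_iid_sum_sq_le p _ N).trans ?_
        rw [expect_list_sum]
    _ = N * expect p (fun y => expect (iid p N) fun l => (l.map fun x => F x y).sum ^ 2) +
        (N : ℝ≥0∞) ^ 2 *
          expect (iid p N) fun l => (l.map fun x => expect p fun y => F x y).sum ^ 2 := by
        simp only [mul_pow]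
        rw [expect_add, expect_const_mul, expect_const_mul, expect_comm]
    _ ≤ N * expect p (fun y => N * expect p (fun x => F x y) +
          N ^ 2 * (expect p fun x => F x y) ^ 2) +
            (N : ℝ≥0∞) ^ 2 * (N * (τ * P) + (N * P) ^ 2) := by
        gcongr N * ?_ + _ * ?_
        · refine expect_mono fun y => (expect_iid_sum_sq_le p _ N).trans (le_of_eq ?_)
          simp only [hF, mul_pow]
        · refine (expect_iid_sum_sq_le p _ N).trans ?_
          rw [hP]
          gcongr
          exact (expect_sq_le_mul_expect h₁).trans_eq (by rw [hP])
    _ ≤ N * (N * P + N ^ 2 * (τ * P)) + (N : ℝ≥0∞) ^ 2 * (N * (τ * P) + (N * P) ^ 2) := by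
        gcongr N * ?_ + _
        rw [expect_add, expect_const_mul, expect_const_mul, hP']
        gcongr
        exact (expect_sq_le_mul_expect h₂).trans_eq (by rw [hP'])
    _ = _ := by ring

theorem expect_pr_forall_not_rel_le {R : α → α → Prop} {τ ρ : ℝ} (hτ : 0 ≤ τ) (hρ : 0 < ρ)
    (h₁ : ∀ x, pr p (fun y => R x y) ≤ ENNReal.ofReal τ)
    (h₂ : ∀ y, pr p (fun x => R x y) ≤ ENNReal.ofReal τ)
    (hP : (expect p fun x => pr p fun y => R x y) = ENNReal.ofReal ρ) {N : ℕ} (hN : 0 < N) :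
    (expect (iid p N) fun l => pr (iid p N) fun l' => ∀ y ∈ l', ∀ x ∈ l, ¬ R x y) ≤
      ENNReal.ofReal ((1 + 2 * N * τ) / (N ^ 2 * ρ)) := by
  classical
  let f : α → α → ℝ≥0 := fun x y => if R x y then 1 else 0
  have hf : ∀ x y, (f x y : ℝ≥0∞) = if R x y then 1 else 0 := fun x y => by
    simp only [f]; split_ifs <;> simp
  have hf_sq : ∀ x y, (f x y : ℝ≥0∞) ^ 2 = f x y := fun x y => by
    rw [hf]; split_ifs <;> simp
  simp only [pr_eq_expect, ← hf] at h₁ h₂ hP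
  let q : PMF (List α × List α) := (iid p N).bind fun l =>
    (iid p N).bind fun l' => PMF.pure (l, l')
  let Y : List α × List α → ℝ≥0 := fun r => (r.2.map fun y => (r.1.map fun x => f x y).sum).sum
  have mean : expect q (fun r => (Y r : ℝ≥0∞)) = ENNReal.ofReal ((N : ℝ) ^ 2 * ρ) := by
    simp only [q, Y, expect_bind, expect_pure, coe_sum_map]
    rw [expect_iid_iid_sum_sum p (fun x y => (f x y : ℝ≥0∞)), hP,
      ENNReal.ofReal_mul (by positivity), ENNReal.ofReal_pow (by positivity),
      ENNReal.ofReal_natCast]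
  have second : expect q (fun r => (Y r : ℝ≥0∞) ^ 2) ≤
      ENNReal.ofReal (((N : ℝ) ^ 2 * ρ) ^ 2 + ((N : ℝ) ^ 2 * ρ + 2 * N ^ 3 * τ * ρ)) := by
    simp only [q, Y, expect_bind, expect_pure, coe_sum_map]
    refine (expect_iid_iid_sum_sum_sq_le hf_sq h₁ h₂ hP N).trans_eq ?_
    rw [add_comm, ENNReal.ofReal_add (by positivity) (by positivity),
      ENNReal.ofReal_add (by positivity) (by positivity),
      ENNReal.ofReal_pow (by positivity), ENNReal.ofReal_mul (by positivity),
      ENNReal.ofReal_mul (by positivity), ENNReal.ofReal_mul (by positivity),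
      ENNReal.ofReal_mul (by positivity), ENNReal.ofReal_pow (by positivity),
      ENNReal.ofReal_pow (by positivity), ENNReal.ofReal_natCast, ENNReal.ofReal_ofNat]
  calc _ = pr q (fun r => ∀ y ∈ r.2, ∀ x ∈ r.1, ¬ R x y) := by
        simp only [q, pr_eq_expect, expect_bind, expect_pure]
    _ ≤ pr q (fun r => Y r = 0) := by
        refine pr_mono fun r _ hr => ?_
        simp only [Y, List.sum_eq_zero_iff, List.forall_mem_map]
        exact fun y hy x hx => if_neg (hr y hy x hx)
    _ ≤ ENNReal.ofReal (((N : ℝ) ^ 2 * ρ + 2 * N ^ 3 * τ * ρ) / ((N : ℝ) ^ 2 * ρ) ^ 2) :=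
        pr_eq_zero_le (by positivity) (by positivity) mean second
    _ = ENNReal.ofReal ((1 + 2 * N * τ) / (N ^ 2 * ρ)) := by
        congr 1
        field_simp

end RelatedPairs

end IndependentSamples

namespace InputGraph

variable (G : InputGraph)

/-- The degree of a vertex. -/
noncomputable def deg (x : ℕ) : ℕ := #(G.nbrs x)

section Basic

variable {G} {x y : ℕ}

theorem mem_nbrs : y ∈ G.nbrs x ↔ G.graph.Adj x y := by
  classical
  rw [nbrs, Finset.mem_filter]
  exact ⟨fun h => h.2, fun h => ⟨G.mem_of_adj y x h.symm, h⟩⟩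

theorem nbrs_subset_verts : G.nbrs x ⊆ G.verts := by
  classical exact Finset.filter_subset _ _

theorem mem_nbrs_comm : y ∈ G.nbrs x ↔ x ∈ G.nbrs y := by
  rw [mem_nbrs, mem_nbrs, SimpleGraph.adj_comm]

theorem notMem_nbrs_self : x ∉ G.nbrs x := fun h => G.graph.irrefl (mem_nbrs.mp h)

theorem nbrs_nonempty (hx : x ∈ G.verts) : (G.nbrs x).Nonempty :=
  let ⟨y, hy⟩ := G.exists_adj x hx
  ⟨y, mem_nbrs.mpr hy⟩

theorem deg_pos (hx : x ∈ G.verts) : 0 < G.deg x := (nbrs_nonempty hx).card_pos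

theorem deg_lt_numVerts (hx : x ∈ G.verts) : G.deg x < G.numVerts :=
  Finset.card_lt_card
    ((Finset.ssubset_iff_of_subset nbrs_subset_verts).mpr ⟨x, hx, notMem_nbrs_self⟩)

end Basic

section EdgesIn

open Classical in
theorem edgesIn_eq_card_filter_product (S : Finset ℕ) :
    G.edgesIn S = #{e ∈ S ×ˢ S | e.1 < e.2 ∧ G.graph.Adj e.1 e.2} := by
  have h := Finset.sum_sym2_filter_not_isDiag S
    fun e => if e ∈ G.graph.edgeSet then 1 else 0
  rw [Finset.sum_ite, Finset.sum_ite] at h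
  simp only [Finset.sum_const, smul_eq_mul, mul_one, mul_zero, add_zero, Finset.filter_filter] at h
  rw [edgesIn]
  convert h using 2
  · ext e
    simp only [Finset.mem_filter]
    exact and_congr_right fun _ =>
      ⟨fun he => ⟨G.graph.not_isDiag_of_mem_edgeSet he, he⟩, fun he => he.2⟩
  · ext ⟨x, y⟩
    simp only [Finset.mem_filter, Finset.mem_product, Finset.mem_offDiag,
      SimpleGraph.mem_edgeSet]
    exact ⟨fun ⟨⟨hx, hy⟩, hlt, ha⟩ => ⟨⟨hx, hy, hlt.ne⟩, hlt, ha⟩,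
      fun ⟨⟨hx, hy, _⟩, hlt, ha⟩ => ⟨⟨hx, hy⟩, hlt, ha⟩⟩

open Classical in
theorem two_mul_edgesIn (S : Finset ℕ) :
    2 * G.edgesIn S = #{e ∈ S ×ˢ S | G.graph.Adj e.1 e.2} := by
  have swap : #{e ∈ S ×ˢ S | e.1 < e.2 ∧ G.graph.Adj e.1 e.2} =
      #{e ∈ S ×ˢ S | ¬ e.1 < e.2 ∧ G.graph.Adj e.1 e.2} := by
    refine Finset.card_equiv (Equiv.prodComm ℕ ℕ) fun ⟨x, y⟩ => ?_
    simp only [Finset.mem_filter, Finset.mem_product, Equiv.prodComm_apply, Prod.swap_prod_mk,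
      G.graph.adj_comm y x, and_comm (a := y ∈ S)]
    refine and_congr_right fun _ => and_congr_left fun ha => ?_
    rw [not_lt, le_iff_lt_or_eq, or_iff_left ha.ne]
  rw [two_mul]
  nth_rw 2 [edgesIn_eq_card_filter_product]
  rw [swap, edgesIn_eq_card_filter_product,
    ← Finset.card_filter_add_card_filter_not (s := {e ∈ S ×ˢ S | G.graph.Adj e.1 e.2})
      (fun e => e.1 < e.2)]
  simp only [Finset.filter_filter, and_comm]

open Classical in
theorem edgesIn_pair (x y : ℕ) : G.edgesIn {x, y} = if y ∈ G.nbrs x then 1 else 0 := by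
  have h := G.two_mul_edgesIn {x, y}
  rw [Finset.card_filter, Finset.sum_product] at h
  by_cases hxy : x = y
  · subst hxy
    rw [if_neg notMem_nbrs_self]
    simpa only [Finset.pair_eq_singleton, Finset.sum_singleton, SimpleGraph.irrefl, if_false,
      mul_eq_zero, OfNat.ofNat_ne_zero, false_or] using h
  · simp only [Finset.sum_pair hxy, SimpleGraph.irrefl, if_false, zero_add, add_zero,
      G.graph.adj_comm y x] at h
    simp only [mem_nbrs]
    omega

open Classical in
theorem two_mul_edgesIn_toFinset_le (l : List ℕ) : 2 * G.edgesIn l.toFinset ≤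
    (l.map fun x => (l.map fun y => if y ∈ G.nbrs x then 1 else 0).sum).sum := by
  have sum_toFinset_le (f : ℕ → ℕ) : ∑ x ∈ l.toFinset, f x ≤ (l.map f).sum := by
    rw [Finset.sum_list_map_count]
    refine Finset.sum_le_sum fun x hx => ?_
    rw [smul_eq_mul]
    exact Nat.le_mul_of_pos_left _ (List.count_pos_iff.mpr (List.mem_toFinset.mp hx))
  rw [two_mul_edgesIn, Finset.card_filter, Finset.sum_product]
  simp only [mem_nbrs]
  exact (Finset.sum_le_sum fun x _ => sum_toFinset_le _).trans (sum_toFinset_le _)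

end EdgesIn

section AverageDegree

theorem numVerts_pos : 0 < G.numVerts := G.nonempty.card_pos

theorem sum_deg : ∑ x ∈ G.verts, (G.deg x : ℝ) = G.numVerts * G.avgDegree := by
  classical
  have handshake : ∑ x ∈ G.verts, G.deg x = 2 * G.numEdges := by
    rw [numEdges, two_mul_edgesIn, Finset.card_filter, Finset.sum_product]
    exact Finset.sum_congr rfl fun x _ => by rw [deg, nbrs, Finset.card_filter]
  rw [← Nat.cast_sum, handshake, avgDegree,
    mul_div_cancel₀ _ (by exact_mod_cast G.numVerts_pos.ne'), Nat.cast_mul, Nat.cast_two]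

variable {G} in
theorem le_avgDegree {r : ℝ} (h : ∀ x ∈ G.verts, r ≤ G.deg x) : r ≤ G.avgDegree := by
  have hn : (0 : ℝ) < G.numVerts := by exact_mod_cast G.numVerts_pos
  rw [← mul_le_mul_iff_right₀ hn, ← sum_deg, ← nsmul_eq_mul]
  exact Finset.card_nsmul_le_sum _ _ _ h

variable {G} in
theorem avgDegree_le {r : ℝ} (h : ∀ x ∈ G.verts, G.deg x ≤ r) : G.avgDegree ≤ r := by
  have hn : (0 : ℝ) < G.numVerts := by exact_mod_cast G.numVerts_pos
  rw [← mul_le_mul_iff_right₀ hn, ← sum_deg, ← nsmul_eq_mul]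
  exact Finset.sum_le_card_nsmul _ _ _ h

theorem one_le_avgDegree : 1 ≤ G.avgDegree :=
  le_avgDegree fun _ hx => by exact_mod_cast deg_pos hx

theorem avgDegree_le_numVerts : G.avgDegree ≤ G.numVerts :=
  avgDegree_le fun _ hx => by exact_mod_cast (deg_lt_numVerts hx).le

variable {G} in
theorem card_mul_le_of_le_deg {s : Finset ℕ} {r : ℝ} (hs : s ⊆ G.verts)
    (h : ∀ x ∈ s, r ≤ G.deg x) : #s * r ≤ G.numVerts * G.avgDegree := by
  rw [← sum_deg, ← nsmul_eq_mul]
  exact (Finset.card_nsmul_le_sum _ _ _ h).trans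
    (Finset.sum_le_sum_of_subset_of_nonneg hs fun _ _ _ => by positivity)

theorem sum_card_filter_nbrs_comm (P : ℕ → ℕ → Prop) [DecidableRel P] :
    ∑ x ∈ G.verts, #{y ∈ G.nbrs x | P x y} = ∑ x ∈ G.verts, #{y ∈ G.nbrs x | P y x} := by
  classical
  have card_eq (Q : ℕ → ℕ → Prop) [DecidableRel Q] (x : ℕ) : #{y ∈ G.nbrs x | Q x y} =
      ∑ y ∈ G.verts, if y ∈ G.nbrs x ∧ Q x y then 1 else 0 := by
    rw [← Finset.card_filter, ← Finset.filter_filter, Finset.filter_mem_eq_inter,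
      Finset.inter_eq_right.mpr nbrs_subset_verts]
  simp only [card_eq, card_eq fun x y => P y x]
  rw [Finset.sum_comm]
  simp only [mem_nbrs_comm]

end AverageDegree

section OutNeighbours

/-- The order of the vertices by degree, ties being broken by the identifier. -/
def Below (v u : ℕ) : Prop := G.deg v < G.deg u ∨ (G.deg v = G.deg u ∧ v < u)

variable {G} in
theorem not_below {u v : ℕ} (h : u ≠ v) : ¬ G.Below v u ↔ G.Below u v := by
  simp only [Below]
  omega

open Classical in
/-- The neighbours of `v` that follow it in the order by degree: each edge is oriented towards its
endpoint of larger degree. -/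
noncomputable def out (v : ℕ) : Finset ℕ := {u ∈ G.nbrs v | G.Below v u}

theorem sum_card_out : 2 * ∑ v ∈ G.verts, (#(G.out v) : ℝ) = G.numVerts * G.avgDegree := by
  classical
  have deg_eq (v : ℕ) : G.deg v = #(G.out v) + #{u ∈ G.nbrs v | G.Below u v} := by
    rw [deg, ← Finset.card_filter_add_card_filter_not (G.Below v), out]
    congr 2
    exact Finset.filter_congr fun u hu => not_below (ne_of_mem_of_not_mem hu notMem_nbrs_self)
  rw [← sum_deg]
  simp only [deg_eq, Nat.cast_add, Finset.sum_add_distrib]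
  rw [two_mul, add_right_inj]
  exact_mod_cast G.sum_card_filter_nbrs_comm G.Below

theorem card_out_sq_le (v : ℕ) : (#(G.out v) : ℝ) ^ 2 ≤ G.numVerts * G.avgDegree := by
  classical
  rw [sq]
  refine card_mul_le_of_le_deg ((Finset.filter_subset _ _).trans nbrs_subset_verts) fun u hu => ?_
  have card_le : #(G.out v) ≤ G.deg v := Finset.card_filter_le _ _
  have deg_le : G.deg v ≤ G.deg u := by
    rcases (Finset.mem_filter.mp hu).2 with h | h
    · exact h.le
    · exact h.1.le
  exact_mod_cast card_le.trans deg_le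

end OutNeighbours

section DegreeThreshold

variable (θ : ℝ)

open Classical in
/-- The neighbours of `x` that lie on the same side of the degree threshold `θ`. -/
noncomputable def sameSide (x : ℕ) : Finset ℕ := {y ∈ G.nbrs x | G.deg x ≤ θ ↔ G.deg y ≤ θ}

open Classical in
/-- The neighbours of `x` of degree greater than `θ`. -/
noncomputable def highNbrs (x : ℕ) : Finset ℕ := {y ∈ G.nbrs x | θ < G.deg y}

variable {θ}

theorem card_sameSide_le (hθ : 0 < θ) (h : θ ^ 2 = G.numVerts * G.avgDegree) (x : ℕ) :
    #(G.sameSide θ x) ≤ θ := by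
  classical
  by_cases hx : G.deg x ≤ θ
  · refine le_trans ?_ hx
    exact_mod_cast Finset.card_filter_le _ _
  · refine le_of_mul_le_mul_right ?_ hθ
    rw [← sq, h]
    refine card_mul_le_of_le_deg ((Finset.filter_subset _ _).trans nbrs_subset_verts)
      fun y hy => ?_
    have hy_side := (Finset.mem_filter.mp hy).2
    rw [iff_false_left hx, not_le] at hy_side
    exact hy_side.le

variable {G} in
theorem mem_sameSide_comm {x y : ℕ} : y ∈ G.sameSide θ x ↔ x ∈ G.sameSide θ y := by
  simp only [sameSide, Finset.mem_filter, mem_nbrs_comm (x := x), iff_comm]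

variable {G} in
theorem sameSide_subset_verts {x : ℕ} : G.sameSide θ x ⊆ G.verts :=
  (Finset.filter_subset _ _).trans nbrs_subset_verts

open Classical in
theorem sum_sameSide_add_sum_highNbrs :
    ∑ x ∈ G.verts, (#(G.sameSide θ x) : ℝ) +
      2 * ∑ x ∈ G.verts with G.deg x ≤ θ, (#(G.highNbrs θ x) : ℝ) =
        G.numVerts * G.avgDegree := by
  let upward (x y : ℕ) : Prop := G.deg x ≤ θ ∧ θ < G.deg y
  have low_sum : ∑ x ∈ G.verts with G.deg x ≤ θ, #(G.highNbrs θ x) =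
      ∑ x ∈ G.verts, #{y ∈ G.nbrs x | upward x y} := by
    rw [Finset.sum_filter]
    refine Finset.sum_congr rfl fun x _ => ?_
    split_ifs with hx <;> simp [highNbrs, upward, hx]
  have deg_eq (x : ℕ) : G.deg x = #(G.sameSide θ x) +
      (#{y ∈ G.nbrs x | upward x y} + #{y ∈ G.nbrs x | upward y x}) := by
    rw [sameSide, ← Finset.card_union_of_disjoint, ← Finset.filter_or]
    · refine (Finset.card_filter_add_card_filter_not (s := G.nbrs x)
        fun y => (G.deg x : ℝ) ≤ θ ↔ (G.deg y : ℝ) ≤ θ).symm.trans ?_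
      congr 2
      refine Finset.filter_congr fun y _ => ?_
      simp only [upward, ← not_le]
      tauto
    · exact Finset.disjoint_filter.mpr fun y _ h h' => h'.2.not_ge h.1
  have sum_eq := Finset.sum_congr (rfl : G.verts = G.verts) fun x _ => deg_eq x
  rw [Finset.sum_add_distrib, Finset.sum_add_distrib, ← G.sum_card_filter_nbrs_comm upward,
    ← low_sum, ← two_mul] at sum_eq
  rw [← sum_deg]
  exact_mod_cast sum_eq.symm

theorem le_sum_highNbrs_div_deg (hθ : 0 < θ)
    (h : ∑ x ∈ G.verts, (#(G.sameSide θ x) : ℝ) ≤ G.numVerts * G.avgDegree / 2) :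
    G.numVerts * G.avgDegree / (4 * θ) ≤ ∑ x ∈ G.verts, (#(G.highNbrs θ x) : ℝ) / G.deg x := by
  classical
  calc G.numVerts * G.avgDegree / (4 * θ)
      ≤ (∑ x ∈ G.verts with G.deg x ≤ θ, (#(G.highNbrs θ x) : ℝ)) / θ := by
        rw [div_le_div_iff₀ (by positivity) hθ]
        nlinarith [G.sum_sameSide_add_sum_highNbrs (θ := θ)]
    _ ≤ ∑ x ∈ G.verts with G.deg x ≤ θ, (#(G.highNbrs θ x) : ℝ) / G.deg x := by
        rw [Finset.sum_div]
        refine Finset.sum_le_sum fun x hx => ?_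
        obtain ⟨hx, deg_le⟩ := Finset.mem_filter.mp hx
        have := deg_pos hx
        gcongr
    _ ≤ ∑ x ∈ G.verts, (#(G.highNbrs θ x) : ℝ) / G.deg x :=
        Finset.sum_le_sum_of_subset_of_nonneg (Finset.filter_subset _ _)
          fun _ _ _ => by positivity

end DegreeThreshold

section Scale

theorem avgDegree_pos : 0 < G.avgDegree := zero_lt_one.trans_le G.one_le_avgDegree

/-- The order of magnitude `√(n/d)` of the number of samples that the estimation needs. -/
noncomputable def scale : ℝ := √(G.numVerts / G.avgDegree)

/-- The degree threshold `√(nd)` of the analysis, written as `√(n/d) * d`. -/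
noncomputable def threshold : ℝ := G.scale * G.avgDegree

theorem one_le_scale : 1 ≤ G.scale :=
  Real.one_le_sqrt.mpr ((one_le_div G.avgDegree_pos).mpr G.avgDegree_le_numVerts)

theorem scale_pos : 0 < G.scale := zero_lt_one.trans_le G.one_le_scale

theorem threshold_pos : 0 < G.threshold := mul_pos G.scale_pos G.avgDegree_pos

theorem numVerts_eq : (G.numVerts : ℝ) = G.scale ^ 2 * G.avgDegree := by
  rw [scale, Real.sq_sqrt (div_nonneg (Nat.cast_nonneg _) G.avgDegree_pos.le),
    div_mul_cancel₀ _ G.avgDegree_pos.ne']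

theorem threshold_sq : G.threshold ^ 2 = G.numVerts * G.avgDegree := by
  rw [threshold, numVerts_eq]
  ring

end Scale

end InputGraph

namespace Algorithm

variable (A : Algorithm) (G : InputGraph)

/-- The expectation of `f output cost` over the runs of at most `t` moves from state `s`; a run
that has not halted contributes `0`. -/
noncomputable def payoff (t : ℕ) (s : A.State) (f : ℝ → ℕ → ℝ≥0∞) : ℝ≥0∞ :=
  expect (A.outcome G t s) fun o => o.elim 0 fun r => f r.1 r.2

theorem payoff_zero (s : A.State) (f : ℝ → ℕ → ℝ≥0∞) : A.payoff G 0 s f = 0 := by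
  rw [payoff, outcome, expect_pure, Option.elim_none]

theorem payoff_succ (t : ℕ) (s : A.State) (f : ℝ → ℕ → ℝ≥0∞) :
    A.payoff G (t + 1) s f = expect (A.act s) fun mv =>
      match mv with
      | .output v => f v 0
      | .ask q next => expect (G.answer q) fun a =>
          A.payoff G t (next a) fun v c => f v (q.cost + c) := by
  simp only [payoff, outcome, expect_bind]
  congr 1
  funext mv
  cases mv with
  | output v => rw [expect_pure, Option.elim_some]
  | ask q next => simp only [expect_bind, expect_map, Option.elim_map, Function.comp_def]

variable {A G}

theorem payoff_mono {f g : ℝ → ℕ → ℝ≥0∞} (h : ∀ v q, f v q ≤ g v q) (t : ℕ) (s : A.State) :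
    A.payoff G t s f ≤ A.payoff G t s g :=
  expect_mono fun o => by cases o <;> simp [h]

theorem payoff_add (f g : ℝ → ℕ → ℝ≥0∞) (t : ℕ) (s : A.State) :
    A.payoff G t s (fun v q => f v q + g v q) = A.payoff G t s f + A.payoff G t s g := by
  rw [payoff, payoff, payoff, ← expect_add]
  congr 1 with o
  cases o <;> simp

theorem payoff_const_mul (c : ℝ≥0∞) (f : ℝ → ℕ → ℝ≥0∞) (t : ℕ) (s : A.State) :
    A.payoff G t s (fun v q => c * f v q) = c * A.payoff G t s f := by
  rw [payoff, payoff, ← expect_const_mul]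
  congr 1 with o
  cases o <;> simp

theorem payoff_le_one {f : ℝ → ℕ → ℝ≥0∞} (h : ∀ v q, f v q ≤ 1) (t : ℕ) (s : A.State) :
    A.payoff G t s f ≤ 1 :=
  expect_le_of_forall_le fun o => by cases o <;> simp [h]

variable (A G)

theorem payoff_le_payoff_succ (t : ℕ) (s : A.State) (f : ℝ → ℕ → ℝ≥0∞) :
    A.payoff G t s f ≤ A.payoff G (t + 1) s f := by
  induction t generalizing s f with
  | zero => rw [payoff_zero]; exact zero_le
  | succ t ih =>
    rw [payoff_succ, payoff_succ A G (t + 1)]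
    refine expect_mono fun mv => ?_
    cases mv with
    | output v => exact le_rfl
    | ask q next => exact expect_mono fun a => ih _ _

theorem payoff_monotone (s : A.State) (f : ℝ → ℕ → ℝ≥0∞) :
    Monotone fun t => A.payoff G t s f :=
  monotone_nat_of_le_succ fun t => A.payoff_le_payoff_succ G t s f

theorem prob_eq_iSup_payoff (E : ℝ → ℕ → Prop) [∀ v q, Decidable (E v q)] :
    A.prob G E = ⨆ t, A.payoff G t A.init fun v q => if E v q then 1 else 0 := by
  classical
  refine iSup_congr fun t => (pr_eq_expect _ _).trans ?_
  rw [payoff]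
  congr 1 with o
  rcases o with _ | ⟨v, q⟩ <;> simp

variable {A}

theorem prob_le_add_of_imp {E E₁ E₂ : ℝ → ℕ → Prop} (h : ∀ v q, E v q → E₁ v q ∨ E₂ v q) :
    A.prob G E ≤ A.prob G E₁ + A.prob G E₂ := by
  classical
  simp only [prob_eq_iSup_payoff]
  refine iSup_le fun t => le_trans ?_ (add_le_add (le_iSup _ t) (le_iSup _ t))
  rw [← payoff_add]
  refine payoff_mono (fun v q => ?_) _ _
  by_cases hE : E v q
  · rcases h v q hE with h₁ | h₂
    · simp [hE, h₁]
    · simp [hE, h₂]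
  · simp [hE]

theorem prob_mono {E F : ℝ → ℕ → Prop} (h : ∀ v q, E v q → F v q) : A.prob G E ≤ A.prob G F :=
  iSup_mono fun _ => pr_mono fun _ _ ⟨v, q, ho, hE⟩ => ⟨v, q, ho, h v q hE⟩

theorem prob_le_one (E : ℝ → ℕ → Prop) : A.prob G E ≤ 1 := iSup_le fun _ => pr_le_one _ _

theorem prob_add_le_one {E₁ E₂ : ℝ → ℕ → Prop} (h : ∀ v q, E₁ v q → ¬ E₂ v q) :
    A.prob G E₁ + A.prob G E₂ ≤ 1 := by
  classical
  simp only [prob_eq_iSup_payoff]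
  rw [ENNReal.iSup_add_iSup_of_monotone (A.payoff_monotone G _ _) (A.payoff_monotone G _ _)]
  refine iSup_le fun t => ?_
  rw [← payoff_add]
  refine payoff_le_one (fun v q => ?_) _ _
  by_cases h₁ : E₁ v q
  · simp [h₁, h v q h₁]
  · by_cases h₂ : E₂ v q <;> simp [h₁, h₂]

end Algorithm

theorem IsApprox.not_isApprox_of_sq_mul_lt {c d d' v : ℝ} (hc : 0 < c) (h : c ^ 2 * d < d')
    (hv : IsApprox c d v) : ¬ IsApprox c d' v := fun hv' => by
  have lower := hv'.1
  rw [div_le_iff₀ hc] at lower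
  nlinarith [hv.2]

namespace Algorithm

open Classical in
theorem payoff_mul_card_sub_le {A : Algorithm} {ι : Type*} {I : Finset ι} {G₀ : InputGraph}
    {Gs : ι → InputGraph} (h : ∀ q, #{i ∈ I | (Gs i).answer q ≠ G₀.answer q} ≤ q.cost) (t : ℕ)
    (s : A.State) (f : ℝ → ℕ → ℝ≥0∞) :
    A.payoff G₀ t s (fun v q => f v q * ((#I - q : ℕ) : ℝ≥0∞)) ≤
      ∑ i ∈ I, A.payoff (Gs i) t s f := by
  induction t generalizing I s f with
  | zero => simp [payoff_zero]
  | succ t ih =>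
    simp only [payoff_succ]
    rw [← expect_sum]
    refine expect_mono fun mv => ?_
    cases mv with
    | output v => simp [mul_comm]
    | ask q next =>
      dsimp only
      set J := {i ∈ I | (Gs i).answer q = G₀.answer q} with hJ
      have J_subset : J ⊆ I := Finset.filter_subset _ _
      have card_le : #I ≤ #J + q.cost := by
        rw [hJ, ← Finset.card_filter_add_card_filter_not (s := I)
          fun i => (Gs i).answer q = G₀.answer q]
        exact Nat.add_le_add_left (h q) _
      have ih_J (a : Answer) := ih (I := J)
        (fun q' => (Finset.card_le_card (Finset.filter_subset_filter _ J_subset)).trans (h q'))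
        (next a) fun v c => f v (q.cost + c)
      calc _ ≤ expect (G₀.answer q) fun a => ∑ i ∈ J,
            A.payoff (Gs i) t (next a) fun v c => f v (q.cost + c) := by
              refine expect_mono fun a => le_trans (payoff_mono (fun v c => ?_) _ _) (ih_J a)
              gcongr f v _ * ?_
              exact_mod_cast (by omega : #I - (q.cost + c) ≤ #J - c)
        _ = ∑ i ∈ J, expect ((Gs i).answer q) fun a =>
              A.payoff (Gs i) t (next a) fun v c => f v (q.cost + c) := by
              rw [expect_sum]
              exact Finset.sum_congr rfl fun i hi => by rw [(Finset.mem_filter.mp hi).2]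
        _ ≤ _ := Finset.sum_le_sum_of_subset J_subset

variable (A : Algorithm)

open Classical in
theorem mul_prob_le_sum_prob {ι : Type*} {I : Finset ι} {G₀ : InputGraph} {Gs : ι → InputGraph}
    (h : ∀ q, #{i ∈ I | (Gs i).answer q ≠ G₀.answer q} ≤ q.cost) {E : ℝ → ℕ → Prop} {k : ℕ}
    (hE : ∀ v q, E v q → k + q ≤ #I) : k * A.prob G₀ E ≤ ∑ i ∈ I, A.prob (Gs i) E := by
  simp only [prob_eq_iSup_payoff, ENNReal.mul_iSup]
  refine iSup_le fun t => ?_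
  rw [← payoff_const_mul]
  calc _ ≤ A.payoff G₀ t A.init fun v q => (if E v q then 1 else 0) * ((#I - q : ℕ) : ℝ≥0∞) := by
        refine payoff_mono (fun v q => ?_) _ _
        split_ifs with hvq
        · rw [mul_one, one_mul]
          exact_mod_cast (by have := hE v q hvq; omega : k ≤ #I - q)
        · simp
    _ ≤ _ := payoff_mul_card_sub_le h t A.init _
    _ ≤ _ := Finset.sum_le_sum fun i _ => le_iSup (fun t => A.payoff (Gs i) t A.init _) t

open Classical in
theorem quarter_le_prob_of_family {ι : Type*} {I : Finset ι} (hI : I.Nonempty)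
    {G₀ : InputGraph} {Gs : ι → InputGraph}
    (h : ∀ q, #{i ∈ I | (Gs i).answer q ≠ G₀.answer q} ≤ q.cost) {c : ℝ} (hc : 0 < c)
    (hA : ∀ G : InputGraph, 2 / 3 ≤ A.prob G fun v _ => IsApprox c G.avgDegree v)
    (hd : ∀ i ∈ I, c ^ 2 * G₀.avgDegree < (Gs i).avgDegree)
    {T : ℝ} (hT : ∀ q : ℕ, q < T → 5 * q ≤ #I) :
    1 / 4 ≤ A.prob G₀ fun _ q => T ≤ q := by
  let cheap (v : ℝ) (q : ℕ) : Prop := IsApprox c G₀.avgDegree v ∧ q < T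
  have ne_top (G : InputGraph) (E : ℝ → ℕ → Prop) : A.prob G E ≠ ⊤ :=
    ne_top_of_le_ne_top ENNReal.one_ne_top (prob_le_one G E)
  have correct : 2 / 3 ≤ (A.prob G₀ cheap).toReal + (A.prob G₀ fun _ q => T ≤ q).toReal := by
    rw [← ENNReal.toReal_add (ne_top _ _) (ne_top _ _)]
    simpa using ENNReal.toReal_mono (ENNReal.add_ne_top.mpr ⟨ne_top _ _, ne_top _ _⟩)
      ((hA G₀).trans (prob_le_add_of_imp (E₁ := cheap) G₀ fun v q hv =>
        (lt_or_ge (q : ℝ) T).imp_left fun hq => ⟨hv, hq⟩))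
  have mistaken (i) (hi : i ∈ I) : (A.prob (Gs i) cheap).toReal ≤ 1 / 3 := by
    have disjoint := (add_le_add_left (hA (Gs i)) _).trans
      (prob_add_le_one (E₂ := cheap) (Gs i) fun v _ hv hv' =>
        hv'.1.not_isApprox_of_sq_mul_lt hc (hd i hi) hv)
    have := ENNReal.toReal_mono ENNReal.one_ne_top disjoint
    rw [ENNReal.toReal_add (ENNReal.div_ne_top (by simp) (by simp)) (ne_top _ _)] at this
    simp only [ENNReal.toReal_div, ENNReal.toReal_ofNat, ENNReal.toReal_one] at this
    linarith
  have transfer : (#I - #I / 5 : ℕ) * (A.prob G₀ cheap).toReal ≤ #I * (1 / 3) := by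
    have := ENNReal.toReal_mono (ENNReal.sum_ne_top.mpr fun i _ => ne_top _ _)
      (A.mul_prob_le_sum_prob h (E := cheap) (k := #I - #I / 5) fun v q hvq => by
        have := hT q hvq.2
        omega)
    rw [ENNReal.toReal_mul, ENNReal.toReal_natCast, ENNReal.toReal_sum fun i _ => ne_top _ _]
      at this
    exact this.trans ((Finset.sum_le_card_nsmul _ _ _ mistaken).trans_eq (nsmul_eq_mul _ _))
  have card_pos : (0 : ℝ) < #I := by exact_mod_cast hI.card_pos
  have card_sub : (4 / 5 : ℝ) * #I ≤ (#I - #I / 5 : ℕ) := by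
    have : (4 * #I : ℝ) ≤ 5 * (#I - #I / 5 : ℕ) := by exact_mod_cast (by omega)
    linarith
  have cheap_le : (A.prob G₀ cheap).toReal ≤ 5 / 12 := by
    nlinarith [ENNReal.toReal_nonneg (a := A.prob G₀ cheap)]
  rw [← ENNReal.toReal_le_toReal (ENNReal.div_ne_top (by simp) (by simp)) (ne_top _ _)]
  simp only [ENNReal.toReal_div, ENNReal.toReal_one, ENNReal.toReal_ofNat]
  linarith

end Algorithm

theorem Query.card_vertices_le_cost (q : Query) : #q.vertices ≤ q.cost := by
  cases q <;> simp [Query.vertices, Query.cost]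

theorem Query.eq_additive_empty_of_cost_eq_zero {q : Query} (h : q.cost = 0) :
    q = .additive ∅ := by
  cases q <;> simp_all [Query.cost]

/-- The graph on `{0, …, n - 1}` in which `0, …, h - 1` are adjacent to every other vertex, and
`B` is a clique: the lower bound hides `B` in the graph with `B = ∅`. -/
def hubClique (n h : ℕ) (B : Finset ℕ) (hn : 2 ≤ n) (hh : 1 ≤ h) : InputGraph where
  verts := Finset.range n
  graph :=
    { Adj := fun x y => x ≠ y ∧ x < n ∧ y < n ∧ (x < h ∨ y < h ∨ (x ∈ B ∧ y ∈ B))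
      symm := ⟨fun x y hxy => ⟨hxy.1.symm, hxy.2.2.1, hxy.2.1, by tauto⟩⟩
      loopless := ⟨fun x hx => hx.1 rfl⟩ }
  nonempty := ⟨0, by rw [Finset.mem_range]; omega⟩
  mem_of_adj := fun x y hxy => Finset.mem_range.mpr hxy.2.1
  exists_adj := fun x hx => by
    rw [Finset.mem_range] at hx
    by_cases h0 : x = 0
    · exact ⟨1, by omega, by omega, by omega, by omega⟩
    · exact ⟨0, by omega, by omega, by omega, by omega⟩

namespace hubClique

open InputGraph

variable {n h : ℕ} {B : Finset ℕ} (hn : 2 ≤ n) (hh : 1 ≤ h)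

theorem numVerts_eq : (hubClique n h B hn hh).numVerts = n := Finset.card_range n

theorem mem_nbrs_iff {x y : ℕ} : y ∈ (hubClique n h B hn hh).nbrs x ↔
    x ≠ y ∧ x < n ∧ y < n ∧ (x < h ∨ y < h ∨ (x ∈ B ∧ y ∈ B)) := mem_nbrs

theorem card_mul_card_sub_one_le (hB : B ⊆ Finset.range n) :
    (#B : ℝ) * (#B - 1) ≤ n * (hubClique n h B hn hh).avgDegree := by
  refine (card_mul_le_of_le_deg (G := hubClique n h B hn hh) hB fun x hx => ?_).trans_eq
    (by rw [numVerts_eq])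
  have erase_subset : B.erase x ⊆ (hubClique n h B hn hh).nbrs x := fun y hy => by
    rw [Finset.mem_erase] at hy
    exact (mem_nbrs_iff hn hh).mpr ⟨hy.1.symm, Finset.mem_range.mp (hB hx),
      Finset.mem_range.mp (hB hy.2), Or.inr (Or.inr ⟨hx, hy.2⟩)⟩
  have card_le := Finset.card_le_card erase_subset
  rw [Finset.card_erase_of_mem hx, Nat.sub_le_iff_le_add] at card_le
  rw [sub_le_iff_le_add]
  exact_mod_cast card_le

theorem deg_empty {x : ℕ} (hhn : h < n) (hx : x < n) :
    (hubClique n h ∅ hn hh).deg x = if x < h then n - 1 else h := by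
  have nbrs_eq : (hubClique n h ∅ hn hh).nbrs x =
      if x < h then (Finset.range n).erase x else Finset.range h := by
    ext y
    rw [mem_nbrs_iff]
    split_ifs with hxh
    · simp only [hxh, hx, Finset.mem_erase, Finset.mem_range]
      tauto
    · simp only [hxh, hx, Finset.mem_range, Finset.notMem_empty]
      exact ⟨by tauto, fun hy => ⟨by omega, trivial, hy.trans hhn, by tauto⟩⟩
  rw [deg, nbrs_eq]
  split_ifs
  · rw [Finset.card_erase_of_mem (Finset.mem_range.mpr hx), Finset.card_range]
  · rw [Finset.card_range]

theorem le_avgDegree_empty (hhn : h < n) : h ≤ (hubClique n h ∅ hn hh).avgDegree := by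
  refine le_avgDegree fun x hx => ?_
  rw [deg_empty hn hh hhn (Finset.mem_range.mp hx)]
  split_ifs
  · exact_mod_cast Nat.le_sub_one_of_lt hhn
  · exact le_rfl

theorem avgDegree_empty_le (hhn : h < n) : (hubClique n h ∅ hn hh).avgDegree ≤ 2 * h := by
  have sum_le : ∑ x ∈ Finset.range n, (hubClique n h ∅ hn hh).deg x ≤ n * (2 * h) :=
    calc _ ≤ ∑ x ∈ Finset.range n, ((if x < h then n else 0) + h) :=
          Finset.sum_le_sum fun x hx => by
            rw [deg_empty hn hh hhn (Finset.mem_range.mp hx)]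
            split_ifs <;> omega
      _ = n * (2 * h) := by
        have filter_eq : {x ∈ Finset.range n | x < h} = Finset.range h := by
          ext x
          simp only [Finset.mem_filter, Finset.mem_range]
          omega
        rw [Finset.sum_add_distrib, ← Finset.sum_filter, filter_eq]
        simp only [Finset.sum_const, Finset.card_range, smul_eq_mul]
        ring
  have n_pos : (0 : ℝ) < n := by exact_mod_cast two_pos.trans_le hn
  refine le_of_mul_le_mul_left ?_ n_pos
  rw [← congrArg Nat.cast (numVerts_eq (B := ∅) hn hh), ← sum_deg, numVerts_eq]
  exact_mod_cast sum_le

theorem answer_eq (q : Query) (hq : ∀ x ∈ q.vertices, x ∉ B) :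
    (hubClique n h B hn hh).answer q = (hubClique n h ∅ hn hh).answer q := by
  classical
  have nbrs_eq (x : ℕ) (hx : x ∉ B) :
      (hubClique n h B hn hh).nbrs x = (hubClique n h ∅ hn hh).nbrs x := by
    ext y
    simp only [mem_nbrs_iff, hx, false_and, Finset.notMem_empty]
  cases q with
  | randVert => rfl
  | randNbr x => simp only [answer, nbrs_eq x (hq x (Finset.mem_singleton_self x))]
  | degree x | fullNbr x =>
    simp only [answer, nbrs_eq x (hq x (Finset.mem_singleton_self x))]
    rfl
  | additive S =>
    have edgesIn_eq : (hubClique n h B hn hh).edgesIn S = (hubClique n h ∅ hn hh).edgesIn S := by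
      simp only [edgesIn_eq_card_filter_product, ← mem_nbrs]
      congr 1
      refine Finset.filter_congr fun e he => ?_
      rw [nbrs_eq _ (hq _ (Finset.mem_product.mp he).1)]
    simp only [answer, edgesIn_eq]
    rfl

end hubClique

section LowerBound

variable {c : ℝ} (hc : 0 < c) {A : Algorithm}
  (hA : ∀ G : InputGraph, 2 / 3 ≤ A.prob G fun v _ => IsApprox c G.avgDegree v)

include hc hA

theorem quarter_le_prob_one_le_cost (G : InputGraph) :
    1 / 4 ≤ A.prob G fun _ q => (1 : ℝ) ≤ q := by
  classical
  set N := ⌈c ^ 2 * G.avgDegree⌉₊ + 2 with hN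
  let K := hubClique N 1 (Finset.range N) (by omega) le_rfl
  have avgDegree_lt : c ^ 2 * G.avgDegree < K.avgDegree := by
    have le_ceil := Nat.le_ceil (c ^ 2 * G.avgDegree)
    have N_eq : (N : ℝ) = ⌈c ^ 2 * G.avgDegree⌉₊ + 2 := by rw [hN]; push_cast; rfl
    have N_pos : (0 : ℝ) < N := by positivity
    have complete := hubClique.card_mul_card_sub_one_le (h := 1) (by omega : 2 ≤ N) le_rfl
      (Finset.Subset.refl (Finset.range N))
    rw [Finset.card_range, mul_le_mul_iff_right₀ N_pos] at complete
    exact lt_of_lt_of_le (by linarith) complete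
  refine A.quarter_le_prob_of_family (Gs := fun _ => K) (Finset.singleton_nonempty ())
    (fun q => ?_) hc hA (fun _ _ => avgDegree_lt) fun q hq => ?_
  · by_cases hq : q.cost = 0
    · rw [Query.eq_additive_empty_of_cost_eq_zero hq]
      simp [InputGraph.answer, InputGraph.edgesIn]
    · exact (Finset.card_filter_le _ _).trans (Nat.one_le_iff_ne_zero.mpr hq)
  · have : q < 1 := by exact_mod_cast hq
    omega

theorem quarter_le_prob_hubClique {n h k : ℕ} (hn : 2 ≤ n) (hh : 1 ≤ h) (hk : 0 < k)
    (hkn : k ≤ n) (hkd : c ^ 2 * (n * (hubClique n h ∅ hn hh).avgDegree) < (k : ℝ) * (k - 1))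
    {T : ℝ} (hT : ∀ q : ℕ, q < T → 5 * q ≤ n / k) :
    1 / 4 ≤ A.prob (hubClique n h ∅ hn hh) fun _ q => T ≤ q := by
  classical
  let block (i : ℕ) : Finset ℕ := Finset.Ico (i * k) (i * k + k)
  have block_subset (i) (hi : i ∈ Finset.range (n / k)) : block i ⊆ Finset.range n := fun x hx => by
    rw [Finset.mem_range] at hi ⊢
    have : (i + 1) * k ≤ n := (Nat.mul_le_mul_right k hi).trans (Nat.div_mul_le_self n k)
    linarith [(Finset.mem_Ico.mp hx).2]
  have div_eq_of_mem_block (i x) (hx : x ∈ block i) : x / k = i :=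
    have hx := Finset.mem_Ico.mp hx
    Nat.div_eq_of_lt_le hx.1 (by linarith [hx.2])
  refine A.quarter_le_prob_of_family (I := Finset.range (n / k))
    (Gs := fun i => hubClique n h (block i) hn hh)
    (Finset.nonempty_range_iff.mpr (Nat.div_pos hkn hk).ne') (fun q => ?_) hc hA (fun i hi => ?_)
    (by simpa only [Finset.card_range] using hT)
  · calc _ ≤ #(q.vertices.image (· / k)) := Finset.card_le_card fun i hi => by
          by_contra hiq
          refine (Finset.mem_filter.mp hi).2 (hubClique.answer_eq hn hh q fun x hx hxi => hiq ?_)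
          exact Finset.mem_image.mpr ⟨x, hx, div_eq_of_mem_block i x hxi⟩
      _ ≤ _ := Finset.card_image_le.trans q.card_vertices_le_cost
  · have dense := hubClique.card_mul_card_sub_one_le (h := h) hn hh (block_subset i hi)
    rw [Nat.card_Ico, Nat.add_sub_cancel_left] at dense
    have n_pos : (0 : ℝ) < n := by exact_mod_cast two_pos.trans_le hn
    refine lt_of_mul_lt_mul_left (lt_of_lt_of_le ?_ dense) n_pos.le
    linarith

theorem quarter_le_prob_hubClique_sqrt {n h : ℕ} (hn : 2 ≤ n) (hh : 1 ≤ h) :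
    1 / 4 ≤ A.prob (hubClique n h ∅ hn hh) fun _ q =>
      1 / (5 * (c + 2)) * √(n / (hubClique n h ∅ hn hh).avgDegree) ≤ q := by
  set d := (hubClique n h ∅ hn hh).avgDegree
  have one_le_d : 1 ≤ d := InputGraph.one_le_avgDegree _
  have two_le_n : (2 : ℝ) ≤ n := by exact_mod_cast hn
  set a := √(n * d)
  have a_sq : a ^ 2 = n * d := Real.sq_sqrt (by positivity)
  have one_le_a : 1 ≤ a := Real.one_le_sqrt.mpr (by nlinarith)
  have sqrt_div : √(n / d) = n / a := by
    rw [eq_div_iff (by positivity), ← Real.sqrt_mul (by positivity),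
      show n / d * (n * d) = (n : ℝ) ^ 2 by field_simp, Real.sqrt_sq (by positivity)]
  rw [sqrt_div, one_div_mul_eq_div, div_div]
  -- A clique on `k ≈ c √(n d)` vertices multiplies the average degree by more than `c ^ 2`.
  set k := ⌈c * a⌉₊ + 1 with hk
  have lt_k : c * a + 1 ≤ k := by
    rw [hk]; push_cast
    linarith [Nat.le_ceil (c * a)]
  have k_le : k ≤ (c + 2) * a := by
    rw [hk]; push_cast
    nlinarith [Nat.ceil_lt_add_one (show 0 ≤ c * a by positivity)]
  have k_large : c ^ 2 * (n * d) < (k : ℝ) * (k - 1) := by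
    rw [← a_sq]
    nlinarith [show 0 < c * a by positivity]
  have five_mul_le {q : ℕ} (hq : q < n / (a * (5 * (c + 2)))) : 5 * (q : ℝ) * k ≤ n := by
    rw [lt_div_iff₀ (by positivity)] at hq
    nlinarith [Nat.cast_nonneg (α := ℝ) q]
  rcases le_or_gt k n with hkn | hkn
  · refine quarter_le_prob_hubClique hc hA hn hh (by omega) hkn k_large fun q hq => ?_
    rw [Nat.le_div_iff_mul_le (by omega)]
    exact_mod_cast five_mul_le hq
  · refine (quarter_le_prob_one_le_cost hc hA _).trans (Algorithm.prob_mono _ fun _ q hq => ?_)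
    refine (le_of_not_gt fun hlt => ?_).trans hq
    have n_lt_k : (n : ℝ) < k := by exact_mod_cast hkn
    have := five_mul_le (q := 1) (by exact_mod_cast hlt)
    rw [Nat.cast_one] at this
    linarith

theorem exists_graph_with_many_queries {n : ℕ} {d : ℝ} (hd : 1 ≤ d) (hdn : d ≤ (n : ℝ) - 1) :
    ∃ G : InputGraph, G.numVerts = n ∧ d / 2 ≤ G.avgDegree ∧ G.avgDegree ≤ 2 * d ∧
      1 / 4 ≤ A.prob G fun _ q => 1 / (5 * (c + 2)) * √(G.numVerts / G.avgDegree) ≤ q := by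
  have hn : 2 ≤ n := by exact_mod_cast (by linarith : (2 : ℝ) ≤ n)
  have hh : 1 ≤ ⌊d⌋₊ := Nat.le_floor (by exact_mod_cast hd)
  have floor_le : ⌊d⌋₊ ≤ d := Nat.floor_le (by linarith)
  have lt_floor : d < ⌊d⌋₊ + 1 := Nat.lt_floor_add_one d
  have one_le_floor : (1 : ℝ) ≤ ⌊d⌋₊ := by exact_mod_cast hh
  have hhn : ⌊d⌋₊ < n := by exact_mod_cast (by linarith : (⌊d⌋₊ : ℝ) < n)
  have := hubClique.le_avgDegree_empty hn hh hhn
  have := hubClique.avgDegree_empty_le hn hh hhn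
  refine ⟨hubClique n ⌊d⌋₊ ∅ hn hh, hubClique.numVerts_eq hn hh, by linarith, by linarith, ?_⟩
  rw [hubClique.numVerts_eq]
  exact quarter_le_prob_hubClique_sqrt hc hA hn hh

end LowerBound

/-- The distribution of the answer to a query for a random vertex. -/
noncomputable def InputGraph.unif (G : InputGraph) : PMF ℕ :=
  PMF.uniformOfFinset G.verts G.nonempty

/-- Terminating query programs of the advanced model that use no randomness of their own. -/
inductive Prog (α : Type) : Type
  | ret (a : α)
  | ask (q : Query) (hq : q ∈ advancedModel) (next : Answer → Prog α)

namespace Prog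

variable {α β : Type}

/-- Sequential composition. -/
def bind : Prog α → (α → Prog β) → Prog β
  | ret a, f => f a
  | ask q hq next, f => ask q hq fun a => (next a).bind f

/-- The list of results of `N` independent runs. -/
def replicate (p : Prog α) : ℕ → Prog (List α)
  | 0 => ret []
  | N + 1 => p.bind fun a => (replicate p N).bind fun l => ret (a :: l)

/-- The distribution of the result of a program. -/
noncomputable def dist (G : InputGraph) : Prog α → PMF α
  | ret a => PMF.pure a
  | ask q _ next => (G.answer q).bind fun a => (next a).dist G

/-- Along every run on `G` that starts with known vertices `K`, only known vertices are asked
about, the number of queries plus their cost is at most `c`, and `Q` holds for the result and the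
vertices then known. -/
def Safe (G : InputGraph) (Q : α → Finset ℕ → Prop) : Prog α → Finset ℕ → ℕ → Prop
  | ret a, K, _ => Q a K
  | ask q _ next, K, c => q.vertices ⊆ K ∧ q.cost + 1 ≤ c ∧
      ∀ a ∈ (G.answer q).support, (next a).Safe G Q (K ∪ a.vertices) (c - (q.cost + 1))

variable {G : InputGraph}

theorem dist_bind (p : Prog α) (f : α → Prog β) :
    (p.bind f).dist G = (p.dist G).bind fun a => (f a).dist G := by
  induction p with
  | ret a => rw [bind, dist, PMF.pure_bind]
  | ask q hq next ih => simp only [bind, dist, PMF.bind_bind, ih]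

theorem dist_bind_ret (p : Prog α) (f : α → β) :
    (p.bind fun a => ret (f a)).dist G = (p.dist G).map f := by
  rw [dist_bind]
  exact PMF.bind_pure_comp _ _

theorem dist_replicate (p : Prog α) (N : ℕ) : (p.replicate N).dist G = iid (p.dist G) N := by
  induction N with
  | zero => rfl
  | succ N ih => simp only [replicate, dist_bind, ih, iid, dist]

theorem Safe.mono {Q R : α → Finset ℕ → Prop} (h : ∀ a K, Q a K → R a K) {p : Prog α}
    {K : Finset ℕ} {c c' : ℕ} (hc : c ≤ c') (hp : p.Safe G Q K c) : p.Safe G R K c' := by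
  induction p generalizing K c c' with
  | ret a => exact h _ _ hp
  | ask q hq next ih =>
    exact ⟨hp.1, hp.2.1.trans hc, fun a ha => ih a (Nat.sub_le_sub_right hc _) (hp.2.2 a ha)⟩

theorem Safe.bind {Q : α → Finset ℕ → Prop} {R : β → Finset ℕ → Prop} {p : Prog α}
    {f : α → Prog β} {K : Finset ℕ} {c c' : ℕ} (hp : p.Safe G Q K c)
    (hf : ∀ a K, Q a K → (f a).Safe G R K c') : (p.bind f).Safe G R K (c + c') := by
  induction p generalizing K c with
  | ret a => exact (hf _ _ hp).mono (fun _ _ h => h) (Nat.le_add_left _ _)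
  | ask q hq next ih =>
    refine ⟨hp.1, hp.2.1.trans (Nat.le_add_right _ _), fun a ha => ?_⟩
    rw [Nat.sub_add_comm hp.2.1]
    exact ih a (hp.2.2 a ha)

theorem Safe.replicate {p : Prog α} {V : α → Finset ℕ} {c : ℕ} {K₀ K : Finset ℕ}
    (hp : ∀ K, K₀ ⊆ K → p.Safe G (fun a K' => K ⊆ K' ∧ V a ⊆ K') K c) (N : ℕ) (hK : K₀ ⊆ K) :
    (p.replicate N).Safe G (fun l K' => l.length = N ∧ K ⊆ K' ∧ ∀ a ∈ l, V a ⊆ K') K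
      (N * c) := by
  induction N generalizing K with
  | zero => exact ⟨rfl, subset_rfl, fun a ha => absurd ha List.not_mem_nil⟩
  | succ N ih =>
    rw [Nat.succ_mul, add_comm (N * c)]
    refine (hp K hK).bind fun a K₁ h₁ => ?_
    rw [← add_zero (N * c)]
    refine (ih (hK.trans h₁.1)).bind fun l K₂ h₂ => ?_
    exact ⟨by rw [List.length_cons, h₂.1], h₁.1.trans h₂.2.1,
      List.forall_mem_cons.mpr ⟨h₁.2.trans h₂.2.1, h₂.2.2⟩⟩

section Queries

/-- A uniformly random vertex. -/
def randVert : Prog ℕ :=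
  ask .randVert (by simp [advancedModel]) fun
    | .vertex x => ret x
    | _ => ret 0

/-- A uniformly random neighbour. -/
def randNbr (x : ℕ) : Prog ℕ :=
  ask (.randNbr x) (by simp [advancedModel]) fun
    | .vertex x => ret x
    | _ => ret 0

/-- The degree of a vertex. -/
def degree (x : ℕ) : Prog ℕ :=
  ask (.degree x) (by simp [advancedModel]) fun
    | .number k => ret k
    | _ => ret 0

/-- The number of edges inside a set. -/
def edgesIn (S : Finset ℕ) : Prog ℕ :=
  ask (.additive S) (by simp [advancedModel]) fun
    | .number k => ret k
    | _ => ret 0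

theorem dist_randVert : randVert.dist G = G.unif := by
  simp only [randVert, dist, InputGraph.answer, InputGraph.unif, ← PMF.bind_pure_comp,
    PMF.bind_bind, Function.comp, PMF.pure_bind, PMF.bind_pure]

theorem dist_randNbr {x : ℕ} (hx : x ∈ G.verts) :
    (randNbr x).dist G = PMF.uniformOfFinset (G.nbrs x) (InputGraph.nbrs_nonempty hx) := by
  simp only [randNbr, dist, InputGraph.answer, InputGraph.nbrs_nonempty hx, dif_pos,
    ← PMF.bind_pure_comp, PMF.bind_bind, Function.comp, PMF.pure_bind, PMF.bind_pure]

theorem dist_degree {x : ℕ} (hx : x ∈ G.verts) : (degree x).dist G = PMF.pure (G.deg x) := by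
  simp only [degree, dist, InputGraph.answer, hx, if_pos, PMF.pure_bind, InputGraph.deg]

theorem dist_edgesIn {S : Finset ℕ} (hS : S ⊆ G.verts) :
    (edgesIn S).dist G = PMF.pure (G.edgesIn S) := by
  simp only [edgesIn, dist, InputGraph.answer, hS, if_pos, PMF.pure_bind]

theorem safe_randVert (K : Finset ℕ) :
    randVert.Safe G (fun x K' => x ∈ G.verts ∧ K ⊆ K' ∧ {x} ⊆ K') K 2 := by
  refine ⟨Finset.empty_subset _, le_rfl, fun a ha => ?_⟩
  rw [InputGraph.answer, PMF.mem_support_map_iff] at ha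
  obtain ⟨x, hx, rfl⟩ := ha
  rw [PMF.mem_support_uniformOfFinset_iff] at hx
  exact ⟨hx, Finset.subset_union_left, Finset.subset_union_right⟩

theorem safe_randNbr {x : ℕ} {K : Finset ℕ} (hx : x ∈ K) (hxG : x ∈ G.verts) :
    (randNbr x).Safe G (fun x K' => K ⊆ K' ∧ {x} ⊆ K') K 2 := by
  refine ⟨Finset.singleton_subset_iff.mpr hx, le_rfl, fun a ha => ?_⟩
  rw [InputGraph.answer, dif_pos (InputGraph.nbrs_nonempty hxG), PMF.mem_support_map_iff] at ha
  obtain ⟨x, -, rfl⟩ := ha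
  exact ⟨Finset.subset_union_left, Finset.subset_union_right⟩

theorem safe_degree {x : ℕ} {K : Finset ℕ} (hx : x ∈ K) :
    (degree x).Safe G (fun _ K' => K ⊆ K') K 2 :=
  ⟨Finset.singleton_subset_iff.mpr hx, le_rfl, fun a _ => by
    cases a <;> exact Finset.subset_union_left⟩

theorem safe_edgesIn {S K : Finset ℕ} (hS : S ⊆ K) :
    (edgesIn S).Safe G (fun _ K' => K ⊆ K') K (#S + 1) :=
  ⟨hS, le_rfl, fun a _ => by cases a <;> exact Finset.subset_union_left⟩

end Queries

end Prog

section Loop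

/-- The algorithm that runs `body 0`, `body 1`, … until one of these programs returns a number.
Moving on to the next program costs one superfluous query, since a move that is not an output has
to be a query. -/
noncomputable def loop (body : ℕ → Prog (Option ℝ)) : Algorithm where
  State := ℕ × Prog (Option ℝ)
  init := (0, body 0)
  act
    | (_, .ret (some v)) => PMF.pure (.output v)
    | (j, .ret none) => PMF.pure (.ask .randVert fun _ => (j + 1, body (j + 1)))
    | (j, .ask q _ next) => PMF.pure (.ask q fun a => (j, next a))

variable (body : ℕ → Prog (Option ℝ)) {G : InputGraph}

/-- The state of `loop body` in which the program `p` remains of `body j`. -/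
def loopState (j : ℕ) (p : Prog (Option ℝ)) : (loop body).State := (j, p)

theorem act_loopState_ret_some (j : ℕ) (v : ℝ) :
    (loop body).act (loopState body j (.ret (some v))) = PMF.pure (.output v) := rfl

theorem act_loopState_ret_none (j : ℕ) :
    (loop body).act (loopState body j (.ret none)) =
      PMF.pure (.ask .randVert fun _ => loopState body (j + 1) (body (j + 1))) := rfl

theorem act_loopState_ask (j : ℕ) (q : Query) (hq : q ∈ advancedModel)
    (next : Answer → Prog (Option ℝ)) :
    (loop body).act (loopState body j (.ask q hq next)) =
      PMF.pure (.ask q fun a => loopState body j (next a)) := rfl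

variable {body}

theorem of_ask_mem_support_act {j : ℕ} {p : Prog (Option ℝ)} {q : Query}
    {next : Answer → (loop body).State}
    (h : Move.ask q next ∈ ((loop body).act (loopState body j p)).support) :
    (q = .randVert ∧ next = fun _ => loopState body (j + 1) (body (j + 1))) ∨
      ∃ hq next', p = .ask q hq next' ∧ next = fun a => loopState body j (next' a) := by
  rcases p with (_ | v) | ⟨q', hq', next'⟩
  · rw [act_loopState_ret_none, PMF.support_pure] at h
    cases h
    exact Or.inl ⟨rfl, rfl⟩
  · rw [act_loopState_ret_some, PMF.support_pure] at h
    cases h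
  · rw [act_loopState_ask, PMF.support_pure] at h
    cases h
    exact Or.inr ⟨hq', next', rfl, rfl⟩

variable (body) in
theorem loop_inModel : (loop body).InModel advancedModel := by
  rintro ⟨j, p⟩ q next h
  rcases of_ask_mem_support_act h with ⟨rfl, -⟩ | ⟨hq, -⟩
  · simp [advancedModel]
  · exact hq

section Safe

variable {Q : Option ℝ → Finset ℕ → Prop} {c : ℕ → ℕ}
  (h : ∀ j K, (body j).Safe G Q K (c j))

include h

theorem exists_safe_of_reachable {s : (loop body).State} {K : Finset ℕ}
    (hs : (loop body).Reachable G s K) :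
    ∃ j p b, s = loopState body j p ∧ p.Safe G Q K b := by
  induction hs with
  | start => exact ⟨0, body 0, _, rfl, h 0 ∅⟩
  | step s K q next a _ hask ha ih =>
    obtain ⟨j, p, b, rfl, hp⟩ := ih
    rcases of_ask_mem_support_act hask with ⟨-, rfl⟩ | ⟨hq, next', rfl, rfl⟩
    · exact ⟨_, _, _, rfl, h _ _⟩
    · exact ⟨_, _, _, rfl, hp.2.2 a ha⟩

theorem loop_onlyDiscovered : (loop body).OnlyDiscovered G := by
  rintro s K q next hs hask
  obtain ⟨j, p, b, rfl, hp⟩ := exists_safe_of_reachable h hs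
  rcases of_ask_mem_support_act hask with ⟨rfl, -⟩ | ⟨hq, next', rfl, -⟩
  · exact Finset.empty_subset _
  · exact hp.1

end Safe

variable (body) in
theorem expect_dist_le_payoff_loop {Q : Option ℝ → Finset ℕ → Prop} (j t : ℕ)
    {p : Prog (Option ℝ)} {K : Finset ℕ} {c : ℕ} {g : ℝ → ℕ → ℝ≥0∞} (hg : ∀ v, Antitone (g v))
    (hp : p.Safe G Q K c) :
    (expect (p.dist G) fun o => o.elim
      ((loop body).payoff G t (loopState body (j + 1) (body (j + 1))) fun v q => g v (c + 1 + q))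
      fun v => g v c) ≤ (loop body).payoff G (c + 1 + t) (loopState body j p) g := by
  induction p generalizing K c g with
  | ret o =>
    rw [show c + 1 + t = c + t + 1 by ring, Algorithm.payoff_succ]
    cases o with
    | some v =>
      simp only [Prog.dist, act_loopState_ret_some, expect_pure, Option.elim_some]
      exact hg v (Nat.zero_le _)
    | none =>
      simp only [Prog.dist, act_loopState_ret_none, expect_pure, Option.elim_none, expect_const]
      refine (Algorithm.payoff_mono (fun v q => hg v ?_) _ _).trans
        ((loop body).payoff_monotone G _ _ (Nat.le_add_left t c))
      simp only [Query.cost]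
      omega
  | ask q hq next ih =>
    obtain ⟨c', rfl⟩ := Nat.exists_eq_add_of_le hp.2.1
    rw [show q.cost + 1 + c' + 1 + t = (q.cost + (c' + 1 + t)) + 1 by ring,
      Algorithm.payoff_succ]
    simp only [Prog.dist, act_loopState_ask, expect_pure, expect_bind]
    refine expect_mono_of_support fun a ha => ?_
    have hnext := hp.2.2 a ha
    rw [Nat.add_sub_cancel_left] at hnext
    refine le_trans (expect_mono fun o => ?_)
      ((ih a (g := fun v k => g v (q.cost + k)) (fun v _ _ hk => hg v (by omega)) hnext).trans
        ((loop body).payoff_monotone G _ _ (Nat.le_add_left _ q.cost)))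
    cases o with
    | some v => exact hg v (by omega)
    | none =>
      simp only [Option.elim_none]
      exact Algorithm.payoff_mono (fun v k => hg v (by omega)) _ _

variable (body) in
open Classical in
/-- The probability that one of `body j, …, body (j + R - 1)` returns a number and that the first
such number satisfies `E`. -/
noncomputable def firstReturn (G : InputGraph) (E : ℝ → Prop) : ℕ → ℕ → ℝ≥0∞
  | 0, _ => 0
  | R + 1, j => expect ((body j).dist G) fun o => o.elim (firstReturn G E R (j + 1))
      fun v => if E v then 1 else 0

section Safe

variable {Q : Option ℝ → Finset ℕ → Prop} {c : ℕ → ℕ}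
  (h : ∀ j K, (body j).Safe G Q K (c j))

include h

theorem firstReturn_le_payoff_loop {E : ℝ → Prop} {R j : ℕ} {g : ℝ → ℕ → ℝ≥0∞}
    (hg : ∀ v, Antitone (g v))
    (hE : ∀ v, E v → 1 ≤ g v (∑ i ∈ Finset.range R, (c (j + i) + 1))) :
    firstReturn body G E R j ≤
      (loop body).payoff G (∑ i ∈ Finset.range R, (c (j + i) + 1)) (loopState body j (body j))
        g := by
  induction R generalizing j g with
  | zero => exact zero_le
  | succ R ih =>
    have sum_eq : ∑ i ∈ Finset.range (R + 1), (c (j + i) + 1) =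
        c j + 1 + ∑ i ∈ Finset.range R, (c (j + 1 + i) + 1) := by
      rw [Finset.sum_range_succ', add_zero, add_comm]
      simp only [add_assoc, add_comm 1]
    rw [sum_eq] at hE ⊢
    refine le_trans (expect_mono fun o => ?_)
      (expect_dist_le_payoff_loop body j _ hg (h j ∅))
    cases o with
    | some v =>
      simp only [Option.elim_some]
      split_ifs with hv
      · exact (hE v hv).trans (hg v (by omega))
      · exact zero_le
    | none => exact ih (fun v _ _ hq => hg v (by omega)) hE

theorem firstReturn_le_prob_loop {E : ℝ → Prop} {R : ℕ} {E' : ℝ → ℕ → Prop}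
    (hE : ∀ v q, E v → q ≤ ∑ i ∈ Finset.range R, (c i + 1) → E' v q) :
    firstReturn body G E R 0 ≤ (loop body).prob G E' := by
  classical
  set b := ∑ i ∈ Finset.range R, (c i + 1)
  refine le_trans ?_ (Algorithm.prob_mono (E := fun v q => E v ∧ q ≤ b) G
    fun v q hvq => hE v q hvq.1 hvq.2)
  rw [Algorithm.prob_eq_iSup_payoff]
  refine le_trans ?_ (le_iSup _ b)
  have le_payoff := firstReturn_le_payoff_loop h (E := E) (R := R) (j := 0)
    (g := fun v q => if E v ∧ q ≤ b then 1 else 0)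
    (fun v q q' hq => by
      dsimp only
      split_ifs with h₁ h₂ <;> first | exact le_rfl | exact zero_le | skip
      exact absurd ⟨h₁.1, hq.trans h₁.2⟩ h₂)
    (fun v hv => by simp [hv, b])
  simp only [zero_add] at le_payoff
  exact le_payoff

end Safe

end Loop

namespace InputGraph

variable {G : InputGraph}

theorem mem_support_unif {x : ℕ} : x ∈ G.unif.support ↔ x ∈ G.verts :=
  PMF.mem_support_uniformOfFinset_iff _ _

theorem pr_unif_mem {S : Finset ℕ} (hS : S ⊆ G.verts) :
    pr G.unif (fun x => x ∈ S) = ENNReal.ofReal ((#S : ℝ) / G.numVerts) :=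
  pr_uniformOfFinset_mem G.nonempty hS

theorem expect_unif_ofReal {f : ℕ → ℝ} (hf : ∀ x ∈ G.verts, 0 ≤ f x) :
    expect G.unif (fun x => ENNReal.ofReal (f x)) =
      ENNReal.ofReal ((∑ x ∈ G.verts, f x) / G.numVerts) :=
  expect_uniformOfFinset_ofReal G.nonempty hf

theorem expect_edgesIn_iid_le (N : ℕ) :
    expect (iid G.unif N) (fun S => (G.edgesIn S.toFinset : ℝ≥0∞)) ≤
      ENNReal.ofReal ((N / G.scale) ^ 2 / 2) := by
  have hn : (0 : ℝ) < G.numVerts := by exact_mod_cast G.numVerts_pos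
  have pairs := expect_iid_sum_sum_le G.unif (fun x y => if y ∈ G.nbrs x then 1 else 0) N
  simp only [notMem_nbrs_self, if_false, expect_const, mul_zero, zero_add, ← pr_eq_expect,
    pr_unif_mem nbrs_subset_verts] at pairs
  rw [expect_unif_ofReal fun x _ => by positivity, ← Finset.sum_div] at pairs
  have two_mul_le : 2 * expect (iid G.unif N) (fun S => (G.edgesIn S.toFinset : ℝ≥0∞)) ≤
      (N : ℝ≥0∞) ^ 2 *
        ENNReal.ofReal ((∑ x ∈ G.verts, (G.deg x : ℝ)) / G.numVerts / G.numVerts) := by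
    rw [← expect_const_mul]
    refine (expect_mono fun S => ?_).trans pairs
    have le_card_pairs : ((2 * G.edgesIn S.toFinset : ℕ) : ℝ≥0∞) ≤ _ :=
      Nat.cast_le.mpr (G.two_mul_edgesIn_toFinset_le S)
    simpa [Nat.cast_list_sum, Function.comp_def] using le_card_pairs
  rw [ENNReal.ofReal_div_of_pos two_pos, ENNReal.ofReal_ofNat,
    ENNReal.le_div_iff_mul_le (by simp) (by simp), mul_comm]
  refine two_mul_le.trans_eq ?_
  rw [← ENNReal.ofReal_natCast, ← ENNReal.ofReal_pow (by positivity),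
    ← ENNReal.ofReal_mul (by positivity), G.sum_deg, G.numVerts_eq]
  have := G.scale_pos
  have := G.avgDegree_pos
  congr 1
  field_simp

theorem notMem_nbrs_of_edgesIn_eq_zero {S : Finset ℕ} (h : G.edgesIn S = 0) {x y : ℕ}
    (hx : x ∈ S) (hy : y ∈ S) : y ∉ G.nbrs x := fun hxy => by
  classical
  have no_pair := G.two_mul_edgesIn S
  rw [h, mul_zero, eq_comm, Finset.card_eq_zero, Finset.filter_eq_empty_iff] at no_pair
  exact no_pair (Finset.mk_mem_product hx hy) (mem_nbrs.mp hxy)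

theorem pr_mem_sameSide_threshold_le (x : ℕ) :
    pr G.unif (fun y => y ∈ G.sameSide G.threshold x) ≤ ENNReal.ofReal (1 / G.scale) := by
  have hX := G.scale_pos
  have hn : (0 : ℝ) < G.numVerts := by exact_mod_cast G.numVerts_pos
  rw [pr_unif_mem sameSide_subset_verts]
  refine ENNReal.ofReal_le_ofReal ?_
  rw [div_le_div_iff₀ hn hX, one_mul]
  calc #(G.sameSide G.threshold x) * G.scale
      ≤ G.threshold * G.scale := by
        gcongr
        exact G.card_sameSide_le G.threshold_pos G.threshold_sq x
    _ = G.numVerts := by rw [threshold, G.numVerts_eq]; ring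

theorem pr_edgesIn_eq_zero_le
    (hF : G.numVerts * G.avgDegree / 2 ≤ ∑ x ∈ G.verts, (#(G.sameSide G.threshold x) : ℝ))
    {s : ℕ} (hs : G.scale ≤ s) :
    pr (iid G.unif (s + s)) (fun S => G.edgesIn S.toFinset = 0) ≤
      ENNReal.ofReal (6 * (G.scale / s)) := by
  have hX := G.scale_pos
  have hn : (0 : ℝ) < G.numVerts := by exact_mod_cast G.numVerts_pos
  have hs₀ : (0 : ℝ) < s := hX.trans_le hs
  obtain ⟨ρ, hρ⟩ : ∃ ρ, (∑ x ∈ G.verts, (#(G.sameSide G.threshold x) : ℝ)) / G.numVerts ^ 2 = ρ :=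
    ⟨_, rfl⟩
  have le_density : 1 / (2 * G.scale ^ 2) ≤ ρ := by
    rw [← hρ, div_le_div_iff₀ (by positivity) (by positivity), one_mul]
    refine le_of_eq_of_le ?_ (mul_le_mul_of_nonneg_right hF (by positivity))
    rw [G.numVerts_eq]
    ring
  have density_eq : (expect G.unif fun x => pr G.unif fun y => y ∈ G.sameSide G.threshold x) =
      ENNReal.ofReal ρ := by
    simp only [pr_unif_mem sameSide_subset_verts]
    rw [expect_unif_ofReal fun x _ => by positivity, ← Finset.sum_div, div_div, ← sq, hρ]
  calc _ ≤ expect (iid G.unif s) fun l => pr (iid G.unif s) fun l' =>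
        ∀ y ∈ l', ∀ x ∈ l, ¬ y ∈ G.sameSide G.threshold x := by
        classical
        rw [pr_eq_expect, expect_iid_add]
        simp only [← pr_eq_expect]
        refine expect_mono fun l => pr_mono fun l' _ h y hy x hx hxy => ?_
        exact notMem_nbrs_of_edgesIn_eq_zero h (by simp [hx]) (by simp [hy])
          (Finset.mem_of_mem_filter _ hxy)
    _ ≤ ENNReal.ofReal ((1 + 2 * s * (1 / G.scale)) / (s ^ 2 * ρ)) :=
        expect_pr_forall_not_rel_le (R := fun x y => y ∈ G.sameSide G.threshold x)
          (one_div_pos.mpr hX).le (lt_of_lt_of_le (by positivity) le_density)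
          pr_mem_sameSide_threshold_le
          (fun y => (pr_mono fun x _ h => G.mem_sameSide_comm.mp h).trans
            (pr_mem_sameSide_threshold_le y)) density_eq (by exact_mod_cast hs₀)
    _ ≤ ENNReal.ofReal (3 * (s / G.scale) / (s ^ 2 * (1 / (2 * G.scale ^ 2)))) := by
        have one_le : 1 ≤ s / G.scale := (one_le_div hX).mpr hs
        refine ENNReal.ofReal_le_ofReal ?_
        gcongr
        rw [mul_one_div, mul_div_assoc]
        linarith
    _ = ENNReal.ofReal (6 * (G.scale / s)) := by
        congr 1
        field_simp
        norm_num

end InputGraph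

/-- A vertex, one of its neighbours, and their degrees. -/
structure EdgeSample where
  src : ℕ
  tgt : ℕ
  degSrc : ℕ
  degTgt : ℕ

namespace EdgeSample

/-- The unbiased estimate of the average degree given by an edge sample: twice the degree of the
source if the target follows it in the order by degree, and `0` otherwise. -/
def weight (x : EdgeSample) : ℕ :=
  if x.degSrc < x.degTgt ∨ (x.degSrc = x.degTgt ∧ x.src < x.tgt) then 2 * x.degSrc else 0

/-- The target of the edge sample is a vertex of `G`, recorded with the right degree. -/
def Valid (G : InputGraph) (x : EdgeSample) : Prop := x.tgt ∈ G.verts ∧ x.degTgt = G.deg x.tgt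

end EdgeSample

/-- A random neighbour of a random vertex, with the degrees of both. -/
def Prog.edgeSample : Prog EdgeSample :=
  randVert.bind fun v => (randNbr v).bind fun u => (degree v).bind fun k =>
    (degree u).bind fun k' => ret ⟨v, u, k, k'⟩

namespace EdgeSample

open Prog

variable {G : InputGraph}

theorem expect_edgeSample (f : EdgeSample → ℝ≥0∞) :
    expect (edgeSample.dist G) f = expect G.unif fun v =>
      expect ((randNbr v).dist G) fun u => f ⟨v, u, G.deg v, G.deg u⟩ := by
  simp only [edgeSample, dist_bind, expect_bind, Prog.dist, expect_pure, dist_randVert]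
  refine expect_congr_of_support fun v hv => expect_congr_of_support fun u hu => ?_
  rw [InputGraph.mem_support_unif] at hv
  rw [dist_randNbr hv, PMF.mem_support_uniformOfFinset_iff] at hu
  rw [dist_degree hv, dist_degree (InputGraph.nbrs_subset_verts hu), expect_pure, expect_pure]

theorem valid_of_mem_support {x : EdgeSample} (hx : x ∈ (edgeSample.dist G).support) :
    x.Valid G := by
  simp only [edgeSample, dist_bind, Prog.dist, dist_randVert, PMF.mem_support_bind_iff,
    PMF.mem_support_pure_iff, InputGraph.mem_support_unif] at hx
  obtain ⟨v, hv, u, hu, -, -, k, hk, rfl⟩ := hx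
  rw [dist_randNbr hv, PMF.mem_support_uniformOfFinset_iff] at hu
  have hu_verts := InputGraph.nbrs_subset_verts hu
  rw [dist_degree hu_verts, PMF.mem_support_pure_iff] at hk
  exact ⟨hu_verts, hk⟩

theorem expect_edgeSample_ofReal {f : EdgeSample → ℝ} (hf : ∀ x, 0 ≤ f x) :
    expect (edgeSample.dist G) (fun x => ENNReal.ofReal (f x)) = ENNReal.ofReal
      ((∑ v ∈ G.verts, (∑ u ∈ G.nbrs v, f ⟨v, u, G.deg v, G.deg u⟩) / G.deg v) / G.numVerts) := by
  rw [expect_edgeSample, ← InputGraph.expect_unif_ofReal fun v _ =>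
    div_nonneg (Finset.sum_nonneg fun _ _ => hf _) (Nat.cast_nonneg _)]
  refine expect_congr_of_support fun v hv => ?_
  rw [dist_randNbr (InputGraph.mem_support_unif.mp hv),
    expect_uniformOfFinset_ofReal _ fun _ _ => hf _]
  rfl

theorem weight_mk (v u : ℕ) [Decidable (G.Below v u)] :
    weight ⟨v, u, G.deg v, G.deg u⟩ = if G.Below v u then 2 * G.deg v else 0 := by
  unfold weight InputGraph.Below
  congr

theorem expect_weight :
    expect (edgeSample.dist G) (fun x => (x.weight : ℝ≥0∞)) = ENNReal.ofReal G.avgDegree := by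
  classical
  have average := expect_edgeSample_ofReal (G := G) fun x => Nat.cast_nonneg x.weight
  simp only [ENNReal.ofReal_natCast] at average
  rw [average]
  congr 1
  rw [div_eq_iff (by exact_mod_cast G.numVerts_pos.ne'), mul_comm, ← G.sum_card_out,
    Finset.mul_sum]
  refine Finset.sum_congr rfl fun v hv => ?_
  have hdeg : (0 : ℝ) < G.deg v := by exact_mod_cast InputGraph.deg_pos hv
  simp only [weight_mk, Nat.cast_ite, Nat.cast_zero]
  rw [← Finset.sum_filter, Finset.sum_const, nsmul_eq_mul, div_eq_iff hdeg.ne', InputGraph.out]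
  push_cast
  ring

theorem expect_weight_sq_le : expect (edgeSample.dist G) (fun x => (x.weight : ℝ≥0∞) ^ 2) ≤
    ENNReal.ofReal (4 * G.threshold * G.avgDegree) := by
  classical
  have average := expect_edgeSample_ofReal (G := G) fun x => sq_nonneg (x.weight : ℝ)
  simp only [ENNReal.ofReal_pow (Nat.cast_nonneg _), ENNReal.ofReal_natCast] at average
  rw [average]
  refine ENNReal.ofReal_le_ofReal ?_
  rw [div_le_iff₀ (by exact_mod_cast G.numVerts_pos), mul_assoc, mul_comm G.avgDegree,
    ← G.sum_deg, Finset.mul_sum]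
  refine Finset.sum_le_sum fun v hv => ?_
  have hdeg : (0 : ℝ) < G.deg v := by exact_mod_cast InputGraph.deg_pos hv
  have card_out_le : (#(G.out v) : ℝ) ≤ G.threshold :=
    abs_le_of_sq_le_sq' ((G.card_out_sq_le v).trans G.threshold_sq.ge) G.threshold_pos.le |>.2
  have sum_eq : ∑ u ∈ G.nbrs v, (weight ⟨v, u, G.deg v, G.deg u⟩ : ℝ) ^ 2 =
      #(G.out v) * (2 * G.deg v) ^ 2 := by
    rw [InputGraph.out, ← nsmul_eq_mul, ← Finset.sum_const, Finset.sum_filter]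
    refine Finset.sum_congr rfl fun u _ => ?_
    rw [weight_mk]
    split_ifs <;> simp
  calc _ = #(G.out v) * (4 * G.deg v : ℝ) := by rw [sum_eq]; field_simp; ring
    _ ≤ G.threshold * (4 * G.deg v) := by gcongr
    _ = 4 * G.threshold * G.deg v := by ring

theorem pr_lt_degTgt_eq (θ : ℝ) :
    pr (edgeSample.dist G) (fun x => θ < x.degTgt) = ENNReal.ofReal
      ((∑ v ∈ G.verts, (#(G.highNbrs θ v) : ℝ) / G.deg v) / G.numVerts) := by
  classical
  have average := expect_edgeSample_ofReal (G := G) (f := fun x => if θ < x.degTgt then 1 else 0)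
    fun x => by split_ifs <;> simp
  simp only [apply_ite ENNReal.ofReal, ENNReal.ofReal_one, ENNReal.ofReal_zero] at average
  rw [pr_eq_expect, average]
  congr 2
  refine Finset.sum_congr rfl fun v _ => ?_
  rw [← Finset.sum_filter, Finset.sum_const, nsmul_one, InputGraph.highNbrs]

theorem pr_le_abs_sum_weight_sub_le {N : ℕ} (hN : 0 < N) {δ : ℝ} (hδ : 0 < δ) :
    pr (iid (edgeSample.dist G) N) (fun L =>
      δ * (N * G.avgDegree) ≤ |((L.map weight).sum : ℝ) - N * G.avgDegree|) ≤
        ENNReal.ofReal (4 * G.scale / (N * δ ^ 2)) := by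
  have hd := G.avgDegree_pos
  have hθ := G.threshold_pos
  have chebyshev := pr_iid_le_abs_sum_sub_le (p := edgeSample.dist G) (f := fun x => x.weight)
    (N := N) (V := 4 * G.threshold * G.avgDegree) (r := δ * (N * G.avgDegree)) hd.le
    (by positivity) (by positivity) (by simpa using expect_weight (G := G))
    (by simpa using expect_weight_sq_le (G := G))
  refine le_of_eq_of_le ?_ (chebyshev.trans_eq ?_)
  · simp only [NNReal.coe_list_sum, Nat.cast_list_sum, List.map_map, Function.comp_def,
      NNReal.coe_natCast]
  · rw [InputGraph.threshold]
    congr 1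
    field_simp

end EdgeSample

namespace Prog

/-- Whether a random vertex is adjacent to `b`, as a number. -/
def hit (b : ℕ) : Prog ℕ := randVert.bind fun a => edgesIn {a, b}

/-- The second half of `hubTest`. With `W` the total weight of the edge samples `L`, which is about
`s * d`, and `H` the number of neighbours that the vertex `x.tgt` of largest sampled degree has
among `s` random vertices, about `s * x.degTgt / n`, the condition `x.degTgt ≤ W * H` amounts to
`n / d ≤ s ^ 2`, without `n` being known. -/
def detectHub (s : ℕ) (L : List EdgeSample) : Prog Bool :=
  match L.argmax EdgeSample.degTgt with
  | none => ret false
  | some x => ((hit x.tgt).replicate s).bind fun H =>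
      ret (decide (x.degTgt ≤ (L.map EdgeSample.weight).sum * H.sum))

/-- A test for `n / d ≤ s ^ 2` that is reliable if many edges join a vertex of degree at most
`√(nd)` to one of larger degree. -/
def hubTest (s : ℕ) : Prog Bool := (edgeSample.replicate s).bind (detectHub s)

/-- A test for `n / d ≤ s ^ 2` that is reliable if many edges join vertices on the same side of the
degree threshold `√(nd)`: it looks for an edge among random vertices. -/
def edgeTest (s : ℕ) : Prog Bool :=
  (randVert.replicate (s + s)).bind fun S => (edgesIn S.toFinset).bind fun e =>
    ret (decide (0 < e))

/-- A test that is unlikely to succeed if `s` is much smaller than `√(n/d)`, and likely to succeed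
if it is much larger. -/
def test (s : ℕ) : Prog Bool := (edgeTest s).bind fun b => if b then ret true else hubTest s

variable {G : InputGraph}

theorem expect_hit {b : ℕ} (hb : b ∈ G.verts) {f : ℕ → ℝ≥0∞} (h0 : f 0 = 0) (h1 : f 1 = 1) :
    expect ((hit b).dist G) f = ENNReal.ofReal (G.deg b / G.numVerts) := by
  classical
  rw [InputGraph.deg, ← InputGraph.pr_unif_mem InputGraph.nbrs_subset_verts, pr_eq_expect]
  simp only [hit, dist_bind, expect_bind, dist_randVert]
  refine expect_congr_of_support fun a ha => ?_
  have pair_subset : {a, b} ⊆ G.verts :=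
    Finset.insert_subset (InputGraph.mem_support_unif.mp ha) (Finset.singleton_subset_iff.mpr hb)
  rw [dist_edgesIn pair_subset, expect_pure, G.edgesIn_pair, apply_ite f, h0, h1]
  simp only [InputGraph.mem_nbrs_comm]

theorem pr_detectHub {s : ℕ} {L : List EdgeSample} {x : EdgeSample}
    (hx : L.argmax EdgeSample.degTgt = some x) (E : Bool → Prop) :
    pr ((detectHub s L).dist G) E = pr (iid ((hit x.tgt).dist G) s) fun H =>
      E (decide (x.degTgt ≤ (L.map EdgeSample.weight).sum * H.sum)) := by
  rw [detectHub, hx]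
  dsimp only
  rw [dist_bind_ret, pr_map, dist_replicate]

theorem pr_detectHub_true_le {s : ℕ} {L : List EdgeSample} (hL : ∀ x ∈ L, x.Valid G) :
    pr ((detectHub s L).dist G) (· = true) ≤
      (L.map EdgeSample.weight).sum * ENNReal.ofReal (s / G.numVerts) := by
  rcases hx : L.argmax EdgeSample.degTgt with _ | x
  · rw [detectHub, hx]
    simp [dist, pr_eq_expect, expect_pure]
  obtain ⟨tgt_mem, degTgt_eq⟩ := hL x (List.argmax_mem hx)
  set W := (L.map EdgeSample.weight).sum
  have hn : (0 : ℝ) < G.numVerts := by exact_mod_cast G.numVerts_pos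
  have hD : 0 < x.degTgt := degTgt_eq ▸ InputGraph.deg_pos tgt_mem
  have markov := mul_pr_le_expect (iid ((hit x.tgt).dist G) s)
    (E := fun H => x.degTgt ≤ W * H.sum) (c := (x.degTgt : ℝ≥0∞))
    (f := fun H => (W : ℝ≥0∞) * (H.map fun k : ℕ => (k : ℝ≥0∞)).sum) fun H _ hH => by
      rw [← Nat.cast_list_sum]
      exact_mod_cast hH
  rw [expect_const_mul, expect_iid_sum, expect_hit tgt_mem (by simp) (by simp),
    ← degTgt_eq] at markov
  simp only [pr_detectHub hx, decide_eq_true_eq]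
  refine (ENNReal.mul_le_mul_iff_right (by exact_mod_cast hD.ne') (by simp)).mp
    (markov.trans_eq ?_)
  rw [ENNReal.ofReal_div_of_pos hn, ENNReal.ofReal_div_of_pos hn, ENNReal.ofReal_natCast,
    ENNReal.ofReal_natCast, ENNReal.ofReal_natCast, ENNReal.div_eq_inv_mul,
    ENNReal.div_eq_inv_mul]
  ring

theorem hits_lt_half_mean {s D W H : ℝ} (hs : 2 * G.scale ≤ s) (hW : s * G.avgDegree / 2 ≤ W)
    (hD : 0 < D) (h : W * H < D) : H < s * (D / G.numVerts) / 2 := by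
  have hX := G.scale_pos
  have hd := G.avgDegree_pos
  have hn : (0 : ℝ) < G.numVerts := by exact_mod_cast G.numVerts_pos
  have hs₀ : 0 < s := by linarith
  by_contra! many_hits
  refine h.not_ge ?_
  calc D ≤ D * (s / (2 * G.scale)) ^ 2 :=
        le_mul_of_one_le_right hD.le (one_le_pow₀ ((one_le_div (by positivity)).mpr hs))
    _ = s * G.avgDegree / 2 * (s * (D / G.numVerts) / 2) := by
        rw [G.numVerts_eq]
        field_simp
    _ ≤ W * H := mul_le_mul hW many_hits (by positivity) (le_trans (by positivity) hW)

theorem pr_detectHub_false_le {s : ℕ} {L : List EdgeSample} (hL : ∀ x ∈ L, x.Valid G)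
    (hs : 2 * G.scale ≤ s) (hW : s * G.avgDegree / 2 ≤ ((L.map EdgeSample.weight).sum : ℕ))
    (hhigh : ∃ x ∈ L, G.threshold < x.degTgt) :
    pr ((detectHub s L).dist G) (· = false) ≤ ENNReal.ofReal (4 * (G.scale / s)) := by
  obtain ⟨y, hy, hyθ⟩ := hhigh
  obtain ⟨x, hx⟩ : ∃ x, L.argmax EdgeSample.degTgt = some x :=
    Option.ne_none_iff_exists'.mp fun h => List.ne_nil_of_mem hy (List.argmax_eq_none.mp h)
  obtain ⟨tgt_mem, degTgt_eq⟩ := hL x (List.argmax_mem hx)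
  have lt_degTgt : G.threshold < x.degTgt :=
    hyθ.trans_le (by exact_mod_cast List.le_of_mem_argmax hy hx)
  have hX := G.scale_pos
  have hθ := G.threshold_pos
  have hs₀ : (0 : ℝ) < s := by linarith
  have hD : (0 : ℝ) < x.degTgt := hθ.trans lt_degTgt
  have hn : (0 : ℝ) < G.numVerts := by exact_mod_cast G.numVerts_pos
  have expect_eq {f : ℕ → ℝ≥0∞} (h0 : f 0 = 0) (h1 : f 1 = 1) :
      expect ((hit x.tgt).dist G) f = ENNReal.ofReal (x.degTgt / G.numVerts) := by
    rw [expect_hit tgt_mem h0 h1, degTgt_eq]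
  calc _ ≤ pr (iid ((hit x.tgt).dist G) s) fun H => s * (x.degTgt / G.numVerts) / 2 ≤
        |((H.map fun k : ℕ => (k : ℝ≥0)).sum : ℝ) - s * (x.degTgt / G.numVerts)| := by
        simp only [pr_detectHub hx, decide_eq_false_iff_not, not_le]
        refine pr_mono fun H _ hH => ?_
        have few_hits := hits_lt_half_mean hs hW hD (H := H.sum) (by exact_mod_cast hH)
        rw [← Nat.cast_list_sum, NNReal.coe_natCast, abs_sub_comm]
        refine le_trans ?_ (le_abs_self _)
        linarith
    _ ≤ ENNReal.ofReal (s * (x.degTgt / G.numVerts) / (s * (x.degTgt / G.numVerts) / 2) ^ 2) :=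
        pr_iid_le_abs_sum_sub_le (by positivity) (by positivity) (by positivity)
          (expect_eq (by simp) (by simp)) (expect_eq (by simp) (by simp)).le
    _ = ENNReal.ofReal (4 * (G.numVerts / (s * x.degTgt))) := by
        congr 1
        field_simp
        norm_num
    _ ≤ ENNReal.ofReal (4 * (G.numVerts / (s * G.threshold))) := by gcongr
    _ = ENNReal.ofReal (4 * (G.scale / s)) := by
        rw [InputGraph.threshold, G.numVerts_eq]
        have := G.avgDegree_pos
        congr 1
        field_simp

variable {s : ℕ}

theorem pr_hubTest_true_le :
    pr ((hubTest s).dist G) (· = true) ≤ ENNReal.ofReal ((s / G.scale) ^ 2) := by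
  have hX := G.scale_pos
  have hd := G.avgDegree_pos
  calc pr ((hubTest s).dist G) (· = true)
      = expect (iid (edgeSample.dist G) s) fun L => pr ((detectHub s L).dist G) (· = true) := by
        rw [hubTest, dist_bind, pr_bind, dist_replicate]
    _ ≤ expect (iid (edgeSample.dist G) s) fun L =>
        ENNReal.ofReal (s / G.numVerts) * (L.map fun x => (x.weight : ℝ≥0∞)).sum := by
        refine expect_mono_of_support fun L hL => ?_
        refine (pr_detectHub_true_le fun x hx =>
          EdgeSample.valid_of_mem_support (mem_support_of_mem_iid hL hx)).trans_eq ?_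
        rw [Nat.cast_list_sum, List.map_map, mul_comm]
        rfl
    _ = ENNReal.ofReal (s / G.numVerts * (s * G.avgDegree)) := by
        rw [expect_const_mul, expect_iid_sum, EdgeSample.expect_weight,
          ENNReal.ofReal_mul (by positivity), ENNReal.ofReal_mul (by positivity),
          ENNReal.ofReal_natCast]
    _ = ENNReal.ofReal ((s / G.scale) ^ 2) := by
        rw [G.numVerts_eq]
        congr 1
        field_simp

theorem pr_iid_edgeSample_no_hub_le
    (hF : ∑ x ∈ G.verts, (#(G.sameSide G.threshold x) : ℝ) ≤ G.numVerts * G.avgDegree / 2)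
    (hs : 0 < s) :
    pr (iid (edgeSample.dist G) s) (fun L => ∀ x ∈ L, ¬ G.threshold < x.degTgt) ≤
      ENNReal.ofReal (4 * (G.scale / s)) := by
  have hX := G.scale_pos
  have : (0 : ℝ) < s := by exact_mod_cast hs
  have hn : (0 : ℝ) < G.numVerts := by exact_mod_cast G.numVerts_pos
  have pr_hub := EdgeSample.pr_lt_degTgt_eq (G := G) G.threshold
  have le_sum := G.le_sum_highNbrs_div_deg G.threshold_pos hF
  generalize (∑ v ∈ G.verts, (#(G.highNbrs G.threshold v) : ℝ) / G.deg v) = σ at pr_hub le_sum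
  have le_prob : 1 / (4 * G.scale) ≤ σ / G.numVerts := by
    rw [le_div_iff₀ hn]
    refine le_of_eq_of_le ?_ le_sum
    rw [InputGraph.threshold]
    have := G.avgDegree_pos
    field_simp
  refine (pr_iid_forall_not_le hs (lt_of_lt_of_le (by positivity) le_prob) pr_hub).trans
    (ENNReal.ofReal_le_ofReal ?_)
  calc 1 / (s * (σ / G.numVerts)) ≤ 1 / (s * (1 / (4 * G.scale))) := by gcongr
    _ = 4 * (G.scale / s) := by field_simp

theorem pr_hubTest_false_le
    (hF : ∑ x ∈ G.verts, (#(G.sameSide G.threshold x) : ℝ) ≤ G.numVerts * G.avgDegree / 2)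
    (hs : 2 * G.scale ≤ s) :
    pr ((hubTest s).dist G) (· = false) ≤ ENNReal.ofReal (24 * (G.scale / s)) := by
  have hX := G.scale_pos
  have hs₀ : 0 < s := by
    have : (0 : ℝ) < s := by linarith
    exact_mod_cast this
  have weight_far := EdgeSample.pr_le_abs_sum_weight_sub_le (G := G) hs₀ (half_pos one_pos)
  rw [hubTest, dist_bind, dist_replicate]
  calc _ ≤ pr (iid (edgeSample.dist G) s) (fun L =>
          1 / 2 * (s * G.avgDegree) ≤
              |((L.map EdgeSample.weight).sum : ℝ) - s * G.avgDegree| ∨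
            ∀ x ∈ L, ¬ G.threshold < x.degTgt) + ENNReal.ofReal (4 * (G.scale / s)) := by
        refine pr_bind_le_add fun L hL hbad => ?_
        push Not at hbad
        refine pr_detectHub_false_le (fun x hx =>
          EdgeSample.valid_of_mem_support (mem_support_of_mem_iid hL hx)) hs ?_ hbad.2
        linarith [(abs_lt.mp hbad.1).1]
    _ ≤ ENNReal.ofReal (4 * G.scale / (s * (1 / 2) ^ 2)) + ENNReal.ofReal (4 * (G.scale / s)) +
        ENNReal.ofReal (4 * (G.scale / s)) := by
        gcongr
        exact (pr_or_le _ _ _).trans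
          (add_le_add weight_far (pr_iid_edgeSample_no_hub_le hF hs₀))
    _ = ENNReal.ofReal (24 * (G.scale / s)) := by
        rw [← ENNReal.ofReal_add (by positivity) (by positivity),
          ← ENNReal.ofReal_add (by positivity) (by positivity)]
        congr 1
        field_simp
        norm_num

theorem pr_edgeTest (E : Bool → Prop) : pr ((edgeTest s).dist G) E =
    pr (iid G.unif (s + s)) fun S => E (decide (0 < G.edgesIn S.toFinset)) := by
  classical
  rw [edgeTest, dist_bind, dist_replicate, dist_randVert, pr_bind, pr_eq_expect]
  refine expect_congr_of_support fun S hS => ?_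
  have subset_verts : S.toFinset ⊆ G.verts := fun x hx =>
    InputGraph.mem_support_unif.mp (mem_support_of_mem_iid hS (List.mem_toFinset.mp hx))
  rw [dist_bind_ret, dist_edgesIn subset_verts, PMF.pure_map, pr_eq_expect, expect_pure]

theorem pr_edgeTest_true_le :
    pr ((edgeTest s).dist G) (· = true) ≤ ENNReal.ofReal (2 * (s / G.scale) ^ 2) := by
  simp only [pr_edgeTest, decide_eq_true_eq]
  refine (pr_le_ofReal_div_of_le_expect one_pos (InputGraph.expect_edgesIn_iid_le (s + s))
    fun S _ hS => ?_).trans_eq ?_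
  · rw [ENNReal.ofReal_one]
    exact_mod_cast hS
  · push_cast
    congr 1
    ring

theorem pr_edgeTest_false_le
    (hF : G.numVerts * G.avgDegree / 2 ≤ ∑ x ∈ G.verts, (#(G.sameSide G.threshold x) : ℝ))
    (hs : G.scale ≤ s) :
    pr ((edgeTest s).dist G) (· = false) ≤ ENNReal.ofReal (6 * (G.scale / s)) := by
  simp only [pr_edgeTest, decide_eq_false_iff_not, not_lt, nonpos_iff_eq_zero]
  exact InputGraph.pr_edgesIn_eq_zero_le hF hs

theorem pr_test_true_le :
    pr ((test s).dist G) (· = true) ≤ ENNReal.ofReal (3 * (s / G.scale) ^ 2) := by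
  rw [test, dist_bind]
  calc _ ≤ pr ((edgeTest s).dist G) (· = true) + ENNReal.ofReal ((s / G.scale) ^ 2) := by
        refine pr_bind_le_add fun b _ hb => ?_
        rw [if_neg hb]
        exact pr_hubTest_true_le
    _ ≤ ENNReal.ofReal (2 * (s / G.scale) ^ 2) + ENNReal.ofReal ((s / G.scale) ^ 2) := by
        gcongr
        exact pr_edgeTest_true_le
    _ = ENNReal.ofReal (3 * (s / G.scale) ^ 2) := by
        rw [← ENNReal.ofReal_add (by positivity) (by positivity)]
        congr 1
        ring

theorem pr_test_false_le (hs : 2 * G.scale ≤ s) :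
    pr ((test s).dist G) (· = false) ≤ ENNReal.ofReal (24 * (G.scale / s)) := by
  have hX := G.scale_pos
  have if_true_false : ∀ b : Bool, b = true →
      pr ((if b then ret true else hubTest s : Prog Bool).dist G) (· = false) = 0 := by
    rintro b rfl
    simp [dist, pr_eq_expect, expect_pure]
  rw [test, dist_bind]
  rcases le_total (G.numVerts * G.avgDegree / 2)
    (∑ x ∈ G.verts, (#(G.sameSide G.threshold x) : ℝ)) with hF | hF
  · calc _ ≤ pr ((edgeTest s).dist G) (· = false) + 0 :=
          pr_bind_le_add fun b _ hb => (if_true_false b (by simpa using hb)).le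
      _ ≤ ENNReal.ofReal (6 * (G.scale / s)) := by
          rw [add_zero]
          exact pr_edgeTest_false_le hF (by linarith)
      _ ≤ ENNReal.ofReal (24 * (G.scale / s)) := by
          gcongr
          norm_num
  · rw [pr_bind, ← expect_const ((edgeTest s).dist G) (ENNReal.ofReal _)]
    refine expect_mono fun b => ?_
    cases b with
    | false => exact pr_hubTest_false_le hF hs
    | true => exact (if_true_false true rfl).le.trans zero_le

end Prog

theorem isApprox_of_abs_sub_lt {ε d v : ℝ} (hε : 0 < ε) (hε1 : ε < 1) (hd : 0 < d)
    (h : |v - d| < ε / 2 * d) : IsApprox (1 + ε) d v := by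
  obtain ⟨lower, upper⟩ := abs_lt.mp h
  refine ⟨(div_le_iff₀ (by positivity)).mpr ?_, by nlinarith⟩
  calc d ≤ (1 - ε / 2) * d * (1 + ε) := by nlinarith [mul_pos hd (mul_pos hε (sub_pos.mpr hε1))]
    _ ≤ v * (1 + ε) := by gcongr; linarith

namespace Prog

/-- The mean weight of `N` edge samples. -/
noncomputable def estimate (N : ℕ) : Prog ℝ :=
  (edgeSample.replicate N).bind fun L => ret (((L.map EdgeSample.weight).sum : ℕ) / N)

/-- The estimate of the average degree from `N` samples, provided that the test with `s` samples
succeeds. -/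
noncomputable def testAndEstimate (s N : ℕ) : Prog (Option ℝ) :=
  (test s).bind fun b => if b then (estimate N).bind fun v => ret (some v) else ret none

variable {G : InputGraph}

theorem pr_not_isApprox_estimate_le {ε : ℝ} (hε : 0 < ε) (hε1 : ε < 1) {N : ℕ} (hN : 0 < N) :
    pr ((estimate N).dist G) (fun v => ¬ IsApprox (1 + ε) G.avgDegree v) ≤
      ENNReal.ofReal (16 * G.scale / (N * ε ^ 2)) := by
  have hd := G.avgDegree_pos
  have hN₀ : (0 : ℝ) < N := by exact_mod_cast hN
  rw [estimate, dist_bind_ret, pr_map, dist_replicate]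
  refine (pr_mono fun L _ hL => ?_).trans
    ((EdgeSample.pr_le_abs_sum_weight_sub_le hN (half_pos hε)).trans_eq ?_)
  · contrapose! hL
    refine isApprox_of_abs_sub_lt hε hε1 hd ?_
    rw [div_sub' hN₀.ne', abs_div, abs_of_pos hN₀, div_lt_iff₀ hN₀]
    linarith
  · congr 1
    ring

theorem pr_testAndEstimate_not_le (E : ℝ → Prop) (s N : ℕ) :
    pr ((testAndEstimate s N).dist G) (fun o => ∃ v ∈ o, ¬ E v) ≤
      min (pr ((test s).dist G) (· = true)) (pr ((estimate N).dist G) fun v => ¬ E v) := by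
  classical
  have given_verdict (b : Bool) : pr ((if b then (estimate N).bind fun v => ret (some v)
      else ret none : Prog (Option ℝ)).dist G) (fun o => ∃ v ∈ o, ¬ E v) =
        if b then pr ((estimate N).dist G) fun v => ¬ E v else 0 := by
    cases b with
    | false => simp [dist, pr_eq_expect, expect_pure]
    | true =>
      simp only [if_true, dist_bind_ret, pr_map]
      simp
  refine le_min ?_ ?_
  · rw [testAndEstimate, dist_bind, ← add_zero (pr _ (· = true))]
    refine pr_bind_le_add fun b _ hb => ?_
    rw [given_verdict, if_neg hb]
  · rw [testAndEstimate, dist_bind, pr_bind]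
    refine expect_le_of_forall_le fun b => ?_
    rw [given_verdict]
    split_ifs
    exacts [le_rfl, zero_le]

theorem pr_testAndEstimate_none_le (s N : ℕ) :
    pr ((testAndEstimate s N).dist G) (· = none) ≤ pr ((test s).dist G) (· = false) := by
  rw [testAndEstimate, dist_bind, ← add_zero (pr _ (· = false))]
  refine pr_bind_le_add fun b _ hb => ?_
  rw [Bool.not_eq_false] at hb
  simp only [hb, if_true, dist_bind_ret, pr_map, reduceCtorEq]
  simp [pr_eq_expect, expect_const]

theorem safe_edgeSample (K : Finset ℕ) :
    edgeSample.Safe G (fun x K' => K ⊆ K' ∧ {x.tgt} ⊆ K') K 8 := by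
  simp only [edgeSample]
  refine (safe_randVert K).bind (c' := 6) fun v K₁ ⟨hv, h₁, hvK⟩ => ?_
  have hvK := Finset.singleton_subset_iff.mp hvK
  refine (safe_randNbr hvK hv).bind (c' := 4) fun u K₂ ⟨h₂, huK⟩ => ?_
  refine (safe_degree (h₂ hvK)).bind (c' := 2) fun _ K₃ h₃ => ?_
  refine (safe_degree (h₃ (Finset.singleton_subset_iff.mp huK))).bind (c' := 0)
    fun _ K₄ h₄ => ?_
  exact ⟨h₁.trans (h₂.trans (h₃.trans h₄)), huK.trans (h₃.trans h₄)⟩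

theorem safe_hit {b : ℕ} {K : Finset ℕ} (hb : b ∈ K) :
    (hit b).Safe G (fun _ K' => K ⊆ K' ∧ ∅ ⊆ K') K 5 := by
  refine (safe_randVert K).bind (c' := 3) fun a K₁ ⟨_, h₁, haK⟩ => ?_
  exact (safe_edgesIn (Finset.insert_subset (Finset.singleton_subset_iff.mp haK)
    (Finset.singleton_subset_iff.mpr (h₁ hb)))).mono
      (fun _ K₂ h₂ => ⟨h₁.trans h₂, Finset.empty_subset _⟩)
      (Nat.succ_le_succ Finset.card_le_two)

theorem safe_detectHub {s : ℕ} {L : List EdgeSample} {K : Finset ℕ} (hL : ∀ x ∈ L, x.tgt ∈ K) :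
    (detectHub s L).Safe G (fun _ _ => True) K (s * 5) := by
  rw [detectHub]
  rcases hx : L.argmax EdgeSample.degTgt with _ | x
  · trivial
  · have hxK := hL x (List.argmax_mem hx)
    exact (Safe.replicate (K₀ := {x.tgt}) (V := fun _ => ∅)
      (fun K' hK' => safe_hit (Finset.singleton_subset_iff.mp hK')) s
      (Finset.singleton_subset_iff.mpr hxK)).bind (c' := 0) fun _ _ _ => trivial

theorem safe_hubTest (s : ℕ) (K : Finset ℕ) :
    (hubTest s).Safe G (fun _ _ => True) K (s * 8 + s * 5) :=
  (Safe.replicate (V := fun x => {x.tgt}) (fun K' _ => safe_edgeSample K') s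
    (Finset.empty_subset K)).bind fun _ _ ⟨_, _, hL⟩ =>
      safe_detectHub fun x hx => Finset.singleton_subset_iff.mp (hL x hx)

theorem safe_edgeTest (s : ℕ) (K : Finset ℕ) :
    (edgeTest s).Safe G (fun _ _ => True) K ((s + s) * 2 + (s + s + 1)) := by
  refine (Safe.replicate (V := fun x => {x}) (fun K' _ => (safe_randVert K').mono
    (fun _ _ h => h.2) le_rfl) (s + s) (Finset.empty_subset K)).bind fun S K₁ ⟨hlen, _, hS⟩ => ?_
  refine Safe.bind (c' := 0) ((safe_edgesIn fun x hx => Finset.singleton_subset_iff.mp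
    (hS x (List.mem_toFinset.mp hx))).mono (fun _ _ h => h) ?_) fun _ _ _ => trivial
  exact Nat.succ_le_succ (S.toFinset_card_le.trans_eq hlen)

theorem safe_test (s : ℕ) (K : Finset ℕ) :
    (test s).Safe G (fun _ _ => True) K (19 * s + 1) := by
  rw [show 19 * s + 1 = (s + s) * 2 + (s + s + 1) + (s * 8 + s * 5) by ring]
  refine (safe_edgeTest s K).bind fun b K₁ _ => ?_
  cases b with
  | false => exact safe_hubTest s K₁
  | true => trivial

theorem safe_estimate (N : ℕ) (K : Finset ℕ) :
    (estimate N).Safe G (fun _ _ => True) K (N * 8) := by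
  rw [estimate]
  exact Safe.bind (c' := 0) (Safe.replicate (V := fun x : EdgeSample => {x.tgt})
    (fun K' _ => safe_edgeSample K') N (Finset.empty_subset K)) fun _ _ _ => trivial

theorem safe_testAndEstimate (s N : ℕ) (K : Finset ℕ) :
    (testAndEstimate s N).Safe G (fun _ _ => True) K (19 * s + 1 + N * 8) := by
  refine (safe_test s K).bind fun b K₁ _ => ?_
  cases b with
  | false => trivial
  | true =>
    exact (safe_estimate N K₁).bind (c' := 0) fun _ _ _ => trivial

end Prog

section Loop

variable {body : ℕ → Prog (Option ℝ)} {G : InputGraph}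

theorem one_le_firstReturn_add (E : ℝ → Prop) (R j : ℕ) :
    1 ≤ firstReturn body G E (R + 1) j +
      ∑ i ∈ Finset.range (R + 1), pr ((body (j + i)).dist G) (fun o => ∃ v ∈ o, ¬ E v) +
      pr ((body (j + R)).dist G) (· = none) := by
  classical
  induction R generalizing j with
  | zero =>
    simp only [zero_add, Finset.sum_range_one, add_zero, firstReturn, pr_eq_expect, ← expect_add]
    refine (expect_const ((body j).dist G) 1).ge.trans (expect_mono fun o => ?_)
    cases o with
    | none => simp
    | some v => by_cases hv : E v <;> simp [hv]
  | succ R ih =>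
    have sum_eq : ∑ i ∈ Finset.range (R + 1 + 1),
        pr ((body (j + i)).dist G) (fun o => ∃ v ∈ o, ¬ E v) =
          pr ((body j).dist G) (fun o => ∃ v ∈ o, ¬ E v) + ∑ i ∈ Finset.range (R + 1),
            pr ((body (j + 1 + i)).dist G) fun o => ∃ v ∈ o, ¬ E v := by
      rw [Finset.sum_range_succ', add_comm, add_zero]
      simp only [add_assoc, add_comm 1]
    have later := ih (j + 1)
    rw [sum_eq, show j + (R + 1) = j + 1 + R by ring, firstReturn]
    generalize (∑ i ∈ Finset.range (R + 1),
      pr ((body (j + 1 + i)).dist G) fun o => ∃ v ∈ o, ¬ E v) = σ at later ⊢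
    generalize pr ((body (j + 1 + R)).dist G) (· = none) = τ at later ⊢
    rw [pr_eq_expect, ← expect_const ((body j).dist G) σ, ← expect_const ((body j).dist G) τ,
      ← expect_add, ← expect_add, ← expect_add]
    refine (expect_const ((body j).dist G) 1).ge.trans (expect_mono fun o => ?_)
    cases o with
    | none => simpa [add_assoc] using later
    | some v => by_cases hv : E v <;> simp [hv, add_assoc]

end Loop

theorem sum_min_le_sq (x c : ℝ) (R : ℕ) :
    ∑ k ∈ Finset.range R, min (3 * (x * 2 ^ k) ^ 2) (c / (x * 2 ^ k)) ≤ (x * 2 ^ R) ^ 2 := by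
  induction R with
  | zero => simpa using sq_nonneg x
  | succ R ih =>
    rw [Finset.sum_range_succ]
    refine (add_le_add ih (min_le_left _ _)).trans_eq ?_
    ring

theorem sum_min_le {x δ c : ℝ} (hx : 0 < x) (hδ : 0 < δ) (hc : 0 ≤ c) (R : ℕ) :
    ∑ k ∈ Finset.range R, min (3 * (x * 2 ^ k) ^ 2) (c / (x * 2 ^ k)) ≤
      4 * δ ^ 2 + 2 * c / δ := by
  have decaying (R : ℕ) (hR : δ ≤ x * 2 ^ R) :
      ∑ k ∈ Finset.range R, min (3 * (x * 2 ^ k) ^ 2) (c / (x * 2 ^ k)) ≤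
        4 * δ ^ 2 + 2 * c / δ - 2 * c / (x * 2 ^ R) := by
    induction R with
    | zero =>
      rw [pow_zero, mul_one] at hR ⊢
      have : 2 * c / x ≤ 2 * c / δ := by gcongr
      rw [Finset.sum_range_zero]
      nlinarith [sq_nonneg δ]
    | succ R ih =>
      rcases le_or_gt δ (x * 2 ^ R) with hδR | hRδ
      · rw [Finset.sum_range_succ]
        refine (add_le_add (ih hδR) (min_le_right _ _)).trans_eq ?_
        field_simp
        ring
      · have tail : 2 * c / (x * 2 ^ (R + 1)) ≤ 2 * c / δ := by gcongr
        have head : (x * 2 ^ (R + 1)) ^ 2 ≤ 4 * δ ^ 2 := by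
          calc (x * 2 ^ (R + 1)) ^ 2 = 4 * (x * 2 ^ R) ^ 2 := by ring
            _ ≤ 4 * δ ^ 2 := by gcongr
        linarith [sum_min_le_sq x c (R + 1)]
  rcases le_total δ (x * 2 ^ R) with hδR | hRδ
  · exact (decaying R hδR).trans (sub_le_self _ (by positivity))
  · calc _ ≤ (x * 2 ^ R) ^ 2 := sum_min_le_sq x c R
      _ ≤ δ ^ 2 := by gcongr
      _ ≤ 4 * δ ^ 2 + 2 * c / δ := by
          have : 0 ≤ 2 * c / δ := by positivity
          nlinarith [sq_nonneg δ]

/-- The number of edge samples from which round `j` computes its estimate. -/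
noncomputable def sampleCount (ε : ℝ) (j : ℕ) : ℕ := ⌈10 ^ 6 * 2 ^ j / ε ^ 2⌉₊

/-- The body of the doubling search for `√(n/d)`, in which `2 ^ j` is the current guess. -/
noncomputable def searchRound (ε : ℝ) (j : ℕ) : Prog (Option ℝ) :=
  Prog.testAndEstimate (2 ^ j) (sampleCount ε j)

/-- The algorithm of part (a) for the precision `ε`. -/
noncomputable def averageDegreeAlgorithm (ε : ℝ) : Algorithm := loop (searchRound ε)

section Search

variable {G : InputGraph} {ε : ℝ}

theorem safe_searchRound (ε : ℝ) (j : ℕ) (K : Finset ℕ) :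
    (searchRound ε j).Safe G (fun _ _ => True) K (19 * 2 ^ j + 1 + sampleCount ε j * 8) :=
  Prog.safe_testAndEstimate _ _ K

theorem pr_searchRound_not_isApprox_le (hε : 0 < ε) (hε1 : ε < 1) (j : ℕ) :
    pr ((searchRound ε j).dist G) (fun o => ∃ v ∈ o, ¬ IsApprox (1 + ε) G.avgDegree v) ≤
      ENNReal.ofReal
        (min (3 * (1 / G.scale * 2 ^ j) ^ 2) (16 / 10 ^ 6 / (1 / G.scale * 2 ^ j))) := by
  have hX := G.scale_pos
  have le_count : 10 ^ 6 * 2 ^ j / ε ^ 2 ≤ sampleCount ε j := Nat.le_ceil _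
  have count_pos : 0 < sampleCount ε j := Nat.ceil_pos.mpr (by positivity)
  rw [ENNReal.ofReal_min]
  refine (Prog.pr_testAndEstimate_not_le _ _ _).trans (min_le_min ?_ ?_)
  · refine Prog.pr_test_true_le.trans_eq ?_
    push_cast
    rw [one_div_mul_eq_div]
  · refine (Prog.pr_not_isApprox_estimate_le hε hε1 count_pos).trans
      (ENNReal.ofReal_le_ofReal ?_)
    calc 16 * G.scale / (sampleCount ε j * ε ^ 2)
        ≤ 16 * G.scale / (10 ^ 6 * 2 ^ j / ε ^ 2 * ε ^ 2) := by gcongr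
      _ = 16 / 10 ^ 6 / (1 / G.scale * 2 ^ j) := by field_simp

theorem lt_firstReturn_searchRound (hε : 0 < ε) (hε1 : ε < 1) {R : ℕ}
    (hR : 9600 * G.scale ≤ 2 ^ R) :
    99 / 100 < firstReturn (searchRound ε) G (IsApprox (1 + ε) G.avgDegree) (R + 1) 0 := by
  have hX := G.scale_pos
  have wrong_output : ∑ j ∈ Finset.range (R + 1), pr ((searchRound ε j).dist G)
      (fun o => ∃ v ∈ o, ¬ IsApprox (1 + ε) G.avgDegree v) ≤ ENNReal.ofReal (1 / 250) := by
    refine (Finset.sum_le_sum fun j _ => pr_searchRound_not_isApprox_le hε hε1 j).trans ?_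
    rw [← ENNReal.ofReal_sum_of_nonneg fun j _ => by positivity]
    refine ENNReal.ofReal_le_ofReal ?_
    refine (sum_min_le (δ := 1 / 40) (one_div_pos.mpr hX) (by norm_num) (by norm_num) _).trans ?_
    norm_num
  have no_output : pr ((searchRound ε R).dist G) (· = none) ≤ ENNReal.ofReal (1 / 400) := by
    refine (Prog.pr_testAndEstimate_none_le _ _).trans
      ((Prog.pr_test_false_le ?_).trans (ENNReal.ofReal_le_ofReal ?_))
    · push_cast
      linarith
    · push_cast
      rw [← mul_div_assoc, div_le_iff₀ (by positivity)]
      linarith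
  have one_le := one_le_firstReturn_add (body := searchRound ε) (G := G)
    (IsApprox (1 + ε) G.avgDegree) R 0
  simp only [zero_add] at one_le
  by_contra! unlikely
  refine (one_le.trans (add_le_add (add_le_add unlikely wrong_output) no_output)).not_gt ?_
  rw [show (99 / 100 : ℝ≥0∞) = ENNReal.ofReal (99 / 100) by
      rw [ENNReal.ofReal_div_of_pos (by norm_num)]; norm_num,
    ← ENNReal.ofReal_add (by norm_num) (by norm_num),
    ← ENNReal.ofReal_add (by norm_num) (by norm_num), ENNReal.ofReal_lt_one]
  norm_num

theorem sum_searchRound_cost_le (hε : 0 < ε) (hε1 : ε < 1) {R : ℕ}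
    (hR : 2 ^ R ≤ 19200 * G.scale) :
    ((∑ j ∈ Finset.range (R + 1), (19 * 2 ^ j + 1 + sampleCount ε j * 8 + 1) : ℕ) : ℝ) ≤
      10 ^ 12 * (1 / ε ^ 2) * G.scale := by
  have hX := G.scale_pos
  have one_le : 1 ≤ 1 / ε ^ 2 := (one_le_div (by positivity)).mpr (pow_le_one₀ hε.le hε1.le)
  have round_cost_le (j : ℕ) : (19 * 2 ^ j + 1 + sampleCount ε j * 8 + 1 : ℝ) ≤
      (8 * 10 ^ 6 + 29) * (1 / ε ^ 2) * 2 ^ j := by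
    have count_lt : (sampleCount ε j : ℝ) < 10 ^ 6 * 2 ^ j / ε ^ 2 + 1 :=
      Nat.ceil_lt_add_one (by positivity)
    have one_le_pow : (1 : ℝ) ≤ 2 ^ j := one_le_pow₀ one_le_two
    have pow_le : (2 : ℝ) ^ j ≤ 1 / ε ^ 2 * 2 ^ j := le_mul_of_one_le_left (by positivity) one_le
    rw [mul_div_assoc, ← one_div_mul_eq_div] at count_lt
    linarith
  push_cast
  calc ∑ j ∈ Finset.range (R + 1), (19 * 2 ^ j + 1 + sampleCount ε j * 8 + 1 : ℝ)
      ≤ ∑ j ∈ Finset.range (R + 1), (8 * 10 ^ 6 + 29) * (1 / ε ^ 2) * 2 ^ j :=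
        Finset.sum_le_sum fun j _ => round_cost_le j
    _ = (8 * 10 ^ 6 + 29) * (1 / ε ^ 2) * (2 * 2 ^ R - 1) := by
        rw [← Finset.mul_sum, geom_sum_eq (by norm_num), pow_succ' (2 : ℝ) R]
        norm_num
    _ ≤ (8 * 10 ^ 6 + 29) * (1 / ε ^ 2) * (38400 * G.scale) := by
        gcongr
        linarith
    _ ≤ 10 ^ 12 * (1 / ε ^ 2) * G.scale := by
        have : 0 ≤ 1 / ε ^ 2 * G.scale := by positivity
        linarith

theorem lt_prob_averageDegreeAlgorithm (G : InputGraph) (hε : 0 < ε) (hε1 : ε < 1) :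
    99 / 100 < (averageDegreeAlgorithm ε).prob G fun v q =>
      IsApprox (1 + ε) G.avgDegree v ∧ (q : ℝ) ≤ 10 ^ 12 * (1 / ε ^ 2) * G.scale := by
  obtain ⟨m, pow_le, lt_pow⟩ := exists_nat_pow_near (x := 9600 * G.scale) (y := 2)
    (by linarith [G.one_le_scale]) one_lt_two
  refine (lt_firstReturn_searchRound hε hε1 lt_pow.le).trans_le
    (firstReturn_le_prob_loop (safe_searchRound ε) fun v q hv hq => ⟨hv, ?_⟩)
  refine le_trans (by exact_mod_cast hq) (sum_searchRound_cost_le hε hε1 ?_)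
  rw [pow_succ]
  linarith

end Search

end AvgDegree

theorem theorem1p4 :
    (∃ (A : ℝ → AvgDegree.Algorithm) (C : ℝ) (k : ℕ), 0 < C ∧
      ∀ ε : ℝ, 0 < ε → ε < 1 →
        (A ε).InModel AvgDegree.advancedModel ∧
        ∀ G : AvgDegree.InputGraph,
          (A ε).OnlyDiscovered G ∧
          99 / 100 < (A ε).prob G (fun v q =>
            AvgDegree.IsApprox (1 + ε) G.avgDegree v ∧
            (q : ℝ) ≤ C * (1 / ε ^ 2) * Real.sqrt ((G.numVerts : ℝ) / G.avgDegree) *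
              Real.log (G.numVerts : ℝ) ^ k)) ∧
    (∀ c : ℝ, 1 < c → ∃ κ : ℝ, 0 < κ ∧
      ∀ A : AvgDegree.Algorithm,
        (∀ G : AvgDegree.InputGraph,
          2 / 3 ≤ A.prob G (fun v _ => AvgDegree.IsApprox c G.avgDegree v)) →
        ∀ (n : ℕ) (d : ℝ), 1 ≤ d → d ≤ (n : ℝ) - 1 →
          ∃ G : AvgDegree.InputGraph,
            G.numVerts = n ∧ d / 2 ≤ G.avgDegree ∧ G.avgDegree ≤ 2 * d ∧
            1 / 4 ≤ A.prob G (fun _ q =>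
              κ * Real.sqrt ((G.numVerts : ℝ) / G.avgDegree) ≤ (q : ℝ))) := by
  refine ⟨⟨AvgDegree.averageDegreeAlgorithm, 10 ^ 12, 0, by norm_num, fun ε hε hε1 =>
    ⟨AvgDegree.loop_inModel _, fun G =>
      ⟨AvgDegree.loop_onlyDiscovered (AvgDegree.safe_searchRound ε), ?_⟩⟩⟩, fun c hc => ?_⟩
  · simpa only [pow_zero, mul_one, AvgDegree.InputGraph.scale] using
      AvgDegree.lt_prob_averageDegreeAlgorithm G hε hε1
  · exact ⟨1 / (5 * (c + 2)), by positivity, fun A hA n d hd hdn =>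
      AvgDegree.exists_graph_with_many_queries (by positivity) hA hd hdn⟩
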